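/- Consider a step-stress accelerated life test with $k\ge 2$ stress levels $x_1<\dots<x_k$ and inspection times $0=t_0<t_1<\dots<t_L$ that include the times of stress change, $\tau_i=t_{l_i}$ with $0=l_0<l_1<\dots<l_k=L$ (so $\tau_0=0$ and $\tau_k=t_L$ ends the test). For $\boldsymbol\theta=(\theta_0,\theta_1)\in\Theta=(0,\infty)\times\mathbb R$ let $\lambda_i=\theta_0e^{\theta_1x_i}$. For $\tau_{i-1}\le t<\tau_i$ (for $t\ge\tau_{k-1}$ if $i=k$) put $$A(t)=t+a_{i-1}-\tau_{i-1},\qquad G_T(t)=1-e^{-\lambda_iA(t)},\qquad g_T(t)=\lambda_ie^{-\lambda_iA(t)},$$ where $a_{i-1}=\frac1{\lambda_i}\sum_{l=1}^{i-1}\lambda_l(\tau_l-\tau_{l-1})$ and $a^*_{i-1}=\frac1{\lambda_i}\sum_{l=1}^{i-1}\lambda_l(\tau_l-\tau_{l-1})(x_l-x_i)$, and $G_T(t)=0$ for $t<0$. Let $\pi_j(\boldsymbol\theta)=G_T(t_j)-G_T(t_{j-1})$ for $1\le j\le L$ and $\pi_{L+1}(\boldsymbol\theta)=1-G_T(t_L)$.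 Let $\boldsymbol W$ be the $(L+1)\times2$ matrix with rows $\boldsymbol z_j-\boldsymbol z_{j-1}$, where $\boldsymbol z_0=\boldsymbol z_{L+1}=\boldsymbol 0$ and, for $1\le j\le L$ and $i$ the stress level in force from time $t_j$ on (level $k$ for $j=L$), $$\boldsymbol z_j=g_T(t_j)\Big(\tfrac{A(t_j)}{\theta_0},\;A(t_j)x_i+a^*_{i-1}\Big)^T .$$ For $\beta\ge0$ put $\boldsymbol J_\beta=\boldsymbol W^T\boldsymbol D^{\beta-1}\boldsymbol W$ and $\boldsymbol K_\beta=\boldsymbol W^T(\boldsymbol D^{2\beta-1}-\boldsymbol\pi^\beta(\boldsymbol\pi^{\beta})^T)\boldsymbol W$, where $\boldsymbol D=\operatorname{diag}(\pi_1,\dots,\pi_{L+1})$ and $\boldsymbol\pi^\beta=(\pi_1^\beta,\dots,\pi_{L+1}^\beta)^T$. The lifetimes of the devices are independent with distribution function $G_T$ at the true parameter value $\boldsymbol\theta_0\in\Theta$, and $\widehat{\boldsymbol p}$ is the vector of the relative frequencies, among the first $N$ devices, of lifetimes in $(t_0,t_1],\dots,(t_{L-1},t_L],(t_L,\infty)$.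 Let $\widehat{\boldsymbol\theta}^\beta$ be the minimum density power divergence estimator (MDPDE): a random vector that, whenever a minimizer exists, minimizes over $\Theta$ the divergence $$d_\beta(\widehat{\boldsymbol p},\boldsymbol\pi(\boldsymbol\theta))=\sum_{j=1}^{L+1}\Big(\pi_j(\boldsymbol\theta)^{1+\beta}-\big(1+\tfrac1\beta\big)\widehat p_j\,\pi_j(\boldsymbol\theta)^\beta+\tfrac1\beta\widehat p_j^{\,\beta+1}\Big)\ (\beta>0),\qquad d_0=\sum_{j=1}^{L+1}\widehat p_j\log\frac{\widehat p_j}{\pi_j(\boldsymbol\theta)} .$$ **Theorem.** Let $x_0\in\mathbb R$ be the stress under normal operating conditions, $0<\alpha<1$, $\beta\ge 0$, and let $$Q_{1-\alpha}=h_1(\boldsymbol\theta)=-\frac{\log(1-\alpha)}{\lambda_0}=-\frac{\log(1-\alpha)}{\theta_0}e^{-\theta_1x_0},\qquad \lambda_0=\theta_0e^{\theta_1x_0},$$ be the lifetime quantile, with plug-in estimator $\widehat Q^\beta_{1-\alpha}=h_1(\widehat{\boldsymbol\theta}^\beta)$. Then $h_1$ has on $\Theta$ the gradient $$\nabla h_1(\boldsymbol\theta)^T=\Big(\frac{\log(1-\alpha)}{\theta_0^2}e^{-\theta_1x_0},\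 \frac{\log(1-\alpha)\,x_0}{\theta_0}e^{-\theta_1x_0}\Big),$$ the matrix $\boldsymbol J_\beta(\boldsymbol\theta_0)$ is invertible, and, as $N\to\infty$, $$\sqrt N\big(\widehat Q^\beta_{1-\alpha}-h_1(\boldsymbol\theta_0)\big)\xrightarrow{\ L\ }\mathcal N\big(0,\sigma^2\big),\qquad \sigma^2=\nabla h_1(\boldsymbol\theta_0)^T\boldsymbol J_\beta^{-1}(\boldsymbol\theta_0)\boldsymbol K_\beta(\boldsymbol\theta_0)\boldsymbol J_\beta^{-1}(\boldsymbol\theta_0)\nabla h_1(\boldsymbol\theta_0)\ge0 .$$ -/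

import Mathlib

open MeasureTheory ProbabilityTheory Filter Topology
open scoped Matrix

noncomputable section

/-- The design of a multiple step-stress accelerated life test: at least two increasing stress
levels `x 1 < ... < x k`, inspection times `0 = t 0 < t 1 < ... < t L`, and the indices
`0 = l 0 < l 1 < ... < l k = L` of those inspection times at which the stress is changed
(for `l k`: at which the test ends). Values of `x`, `t`, `l` at other indices are never used. -/
structure StepStressPlan where
  k : ℕ
  two_le_k : 2 ≤ k
  x : ℕ → ℝ
  x_strictMono : StrictMonoOn x (Set.Icc 1 k)
  L : ℕ
  t : ℕ → ℝ
  t_zero : t 0 = 0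
  t_strictMono : StrictMonoOn t (Set.Icc 0 L)
  l : ℕ → ℕ
  l_zero : l 0 = 0
  l_strictMono : StrictMonoOn l (Set.Icc 0 k)
  l_last : l k = L

/-- Parameters `θ = (θ 0, θ 1)`. -/
abbrev Param := EuclideanSpace ℝ (Fin 2)

/-- The parameter space `Θ = (0, ∞) × ℝ`. -/
def paramSpace : Set Param := {θ | 0 < θ 0}

/-- Log-linear failure rate at stress `s`: `θ₀ exp (θ₁ s)`. -/
def failureRate (θ : Param) (s : ℝ) : ℝ := θ 0 * Real.exp (θ 1 * s)

namespace StepStressPlan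

variable (P : StepStressPlan)

/-- Times of stress change, `τ 0 = 0`, and the end `τ k` of the test. -/
def τ (i : ℕ) : ℝ := P.t (P.l i)

/-- Failure rate at the `i`-th stress level. -/
def rate (θ : Param) (i : ℕ) : ℝ := failureRate θ (P.x i)

/-- The index `i` of the stress level in force at time `s`: `1` for `s < τ 1`, `i` for
`τ (i-1) ≤ s < τ i`, and `k` for all `s ≥ τ (k-1)`. -/
def level (s : ℝ) : ℕ := 1 + ((Finset.Ico 1 P.k).filter (fun i => P.τ i ≤ s)).card

/-- The shift `a_{i-1} = (∑_{l=1}^{i-1} (τ_l - τ_{l-1}) λ_l) / λ_i` (so `a_0 = 0`). -/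
def shift (θ : Param) (i : ℕ) : ℝ :=
  (∑ l ∈ Finset.Ico 1 i, (P.τ l - P.τ (l - 1)) * P.rate θ l) / P.rate θ i

/-- `a*_{i-1} = (1 / λ_i) ∑_{l=1}^{i-1} λ_l (τ_l - τ_{l-1}) (x_l - x_i)`. -/
def shiftStar (θ : Param) (i : ℕ) : ℝ :=
  (1 / P.rate θ i) *
    ∑ l ∈ Finset.Ico 1 i, P.rate θ l * (P.τ l - P.τ (l - 1)) * (-P.x i + P.x l)

/-- The equivalent age `s + a_{i-1} - τ_{i-1}`, `i` being the level in force at time `s`. -/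
def age (θ : Param) (s : ℝ) : ℝ :=
  s + P.shift θ (P.level s) - P.τ (P.level s - 1)

/-- Distribution function `G_T` of the lifetime under the cumulative exposure model. -/
def lifetimeCDF (θ : Param) (s : ℝ) : ℝ :=
  if s < 0 then 0 else 1 - Real.exp (-(P.rate θ (P.level s) * P.age θ s))

/-- Density `g_T` of the lifetime. -/
def lifetimePDF (θ : Param) (s : ℝ) : ℝ :=
  if s < 0 then 0 else
    P.rate θ (P.level s) * Real.exp (-(P.rate θ (P.level s) * P.age θ s))

/-- The cells, indexed from `0`: `(t j, t (j+1)]` for `j < L`, and `(t L, ∞)` for `j = L`. -/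
def cell (j : Fin (P.L + 1)) : Set ℝ :=
  if (j : ℕ) < P.L then Set.Ioc (P.t j) (P.t ((j : ℕ) + 1)) else Set.Ioi (P.t P.L)

/-- Model probabilities of the cells. -/
def cellProb (θ : Param) (j : Fin (P.L + 1)) : ℝ :=
  if (j : ℕ) < P.L then P.lifetimeCDF θ (P.t ((j : ℕ) + 1)) - P.lifetimeCDF θ (P.t j)
  else 1 - P.lifetimeCDF θ (P.t P.L)

open Classical in
/-- Number of the first `N` of the given lifetimes that fall into cell `j`. -/
def count (N : ℕ) (T : ℕ → ℝ) (j : Fin (P.L + 1)) : ℕ :=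
  ((Finset.range N).filter (fun m => T m ∈ P.cell j)).card

/-- Empirical probability vector of the first `N` of the given lifetimes. -/
def empirical (N : ℕ) (T : ℕ → ℝ) (j : Fin (P.L + 1)) : ℝ := (P.count N T j : ℝ) / N

/-- Density power divergence between probability vectors `p` and `q` on the cells; the
Kullback-Leibler divergence for `β = 0`. -/
def dpd (β : ℝ) (p q : Fin (P.L + 1) → ℝ) : ℝ :=
  if β = 0 then ∑ j, p j * Real.log (p j / q j)
  else ∑ j, (q j ^ (1 + β) - (1 + 1 / β) * p j * q j ^ β + (1 / β) * p j ^ (β + 1))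

/-- `θ` is a minimum density power divergence estimate from the empirical vector `p`: a
minimizer over `Θ` of the divergence between `p` and the model. -/
def IsMDPDE (β : ℝ) (p : Fin (P.L + 1) → ℝ) (θ : Param) : Prop :=
  θ ∈ paramSpace ∧ IsMinOn (fun θ' => P.dpd β p (P.cellProb θ')) paramSpace θ

/-- The vectors `z_0 = 0`, `z_j` for `1 ≤ j ≤ L`, and `z_{L+1} = 0`. -/
def z (θ : Param) (j : ℕ) : Fin 2 → ℝ :=
  if j = 0 ∨ P.L < j then 0
  else P.lifetimePDF θ (P.t j) •
    ![P.age θ (P.t j) / θ 0,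
      P.age θ (P.t j) * P.x (P.level (P.t j)) + P.shiftStar θ (P.level (P.t j))]

/-- The `(L+1) × 2` matrix `W` with rows `z_j - z_{j-1}`, `j = 1, ..., L+1`
(row number `j - 1` when counted from `0`). -/
def W (θ : Param) : Matrix (Fin (P.L + 1)) (Fin 2) ℝ :=
  Matrix.of fun j => P.z θ ((j : ℕ) + 1) - P.z θ (j : ℕ)

/-- `J_β(θ) = Wᵀ D^{β-1} W`. -/
def J (β : ℝ) (θ : Param) : Matrix (Fin 2) (Fin 2) ℝ :=
  (P.W θ)ᵀ * Matrix.diagonal (fun j => P.cellProb θ j ^ (β - 1)) * P.W θ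

/-- `K_β(θ) = Wᵀ (D^{2β-1} - π^β (π^β)ᵀ) W`. -/
def K (β : ℝ) (θ : Param) : Matrix (Fin 2) (Fin 2) ℝ :=
  (P.W θ)ᵀ * (Matrix.diagonal (fun j => P.cellProb θ j ^ (2 * β - 1)) -
    Matrix.vecMulVec (fun j => P.cellProb θ j ^ β) (fun j => P.cellProb θ j ^ β)) * P.W θ

end StepStressPlan

/-- The lifetime quantile `Q_{1-α} = -log (1-α) / λ₀` under constant stress `x₀`, as a
function of the parameter. -/
def quantileAt (α x₀ : ℝ) (θ : Param) : ℝ := -Real.log (1 - α) / failureRate θ x₀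

/-- The explicit gradient vector of the quantile. -/
def quantileGrad (α x₀ : ℝ) (θ : Param) : Param :=
  !₂[Real.log (1 - α) / θ 0 ^ 2 * Real.exp (-θ 1 * x₀),
     Real.log (1 - α) * x₀ / θ 0 * Real.exp (-θ 1 * x₀)]

/-- The asymptotic variance `∇h₁ᵀ J_β⁻¹ K_β J_β⁻¹ ∇h₁`. -/
def quantileVar (P : StepStressPlan) (β α x₀ : ℝ) (θ : Param) : ℝ :=
  (quantileGrad α x₀ θ).ofLp ⬝ᵥ
    (((P.J β θ)⁻¹ * P.K β θ * (P.J β θ)⁻¹) *ᵥ (quantileGrad α x₀ θ).ofLp)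

end

/-! The quantity `rate * age` is the cumulative hazard `H(s) = ∑ i, e_i(s) λ_i`, with `e_i(s)` the
time spent under level `i` up to `s`. Hence survival is `exp (-H)`, `z_j` is minus the gradient of
survival at `t j`, and `W` is the Jacobian of the cell probabilities. The values `H(τ 1)` and `H(τ
2)` determine `λ_1` and `λ_2`, which determine `θ` because `x 1 < x 2`. This makes `θ` a continuous
function of the cell probabilities (`tendsto_of_tendsto_cellProb`) and `W` injective
(`eq_zero_of_W_mulVec`), so that `J` is invertible.

The analysis of the estimator is deterministic. Near `π(θ₀)`, any parameter that fits `p` at least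
as well as `θ₀` is close to `θ₀` (`tendsto_of_dpd_le`). This yields existence of a minimizer as well
as consistency of every minimizer. A minimizer solves `Wᵀ D^(β-1) (π - p) = 0`, and linearizing at
`θ₀` gives `θ - θ₀ = J⁻¹ Wᵀ D^(β-1) (p - π(θ₀)) + o(‖p - π(θ₀)‖)`, hence a linear expansion of `h₁`
with coefficient vector `influence`, uniformly over all minimizers
(`eventually_forall_isMDPDE_abs_le`).

Probability enters only through `p̂`. A linear functional of `p̂` is a sample mean of bounded i.i.d.
variables, so the scalar central limit theorem suffices; the variance of one term is the sandwich
expression (`dotProduct_sandwich_mulVec`). Chebyshev's inequality bounds `√N ‖p̂ - π‖` in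
probability, so the remainder is negligible and Slutsky's theorem concludes. -/

noncomputable section

/-! ### Time spent at each stress level and the cumulative hazard -/

namespace StepStressPlan

variable (P : StepStressPlan)

lemma l_le_L {i : ℕ} (hi : i ≤ P.k) : P.l i ≤ P.L := by
  rw [← P.l_last]
  exact P.l_strictMono.monotoneOn ⟨by omega, hi⟩ ⟨by omega, le_rfl⟩ hi

lemma l_lt_l {i j : ℕ} (hij : i < j) (hj : j ≤ P.k) : P.l i < P.l j :=
  P.l_strictMono ⟨by omega, by omega⟩ ⟨by omega, hj⟩ hij

lemma t_lt_t {i j : ℕ} (hij : i < j) (hj : j ≤ P.L) : P.t i < P.t j :=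
  P.t_strictMono ⟨by omega, by omega⟩ ⟨by omega, hj⟩ hij

lemma t_nonneg {i : ℕ} (hi : i ≤ P.L) : 0 ≤ P.t i := by
  rw [← P.t_zero]
  exact P.t_strictMono.monotoneOn ⟨by omega, by omega⟩ ⟨by omega, hi⟩ (by omega)

lemma τ_zero : P.τ 0 = 0 := by simp [τ, P.l_zero, P.t_zero]

lemma τ_lt_τ {i j : ℕ} (hij : i < j) (hj : j ≤ P.k) : P.τ i < P.τ j :=
  P.t_lt_t (P.l_lt_l hij hj) (P.l_le_L hj)

lemma τ_le_τ {i j : ℕ} (hij : i ≤ j) (hj : j ≤ P.k) : P.τ i ≤ P.τ j := by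
  rcases hij.lt_or_eq with h | rfl
  · exact (P.τ_lt_τ h hj).le
  · exact le_rfl

lemma one_le_level (s : ℝ) : 1 ≤ P.level s := by simp [level]

lemma level_le_k (s : ℝ) : P.level s ≤ P.k := by
  have h := Finset.card_filter_le (Finset.Ico 1 P.k) (fun i => P.τ i ≤ s)
  have := P.two_le_k
  simp only [Nat.card_Ico] at h
  unfold level
  omega

/-- Since `τ` increases, the indices counted by `level` form an initial segment, so the cardinality
carries the same information as its largest element. -/
lemma lt_level_iff {i : ℕ} (hi : 1 ≤ i) (hik : i < P.k) (s : ℝ) :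
    i < P.level s ↔ P.τ i ≤ s := by
  unfold level
  constructor
  · intro h
    by_contra hs
    have hsub : (Finset.Ico 1 P.k).filter (fun i => P.τ i ≤ s) ⊆ Finset.Ico 1 i := by
      intro j hj
      simp only [Finset.mem_filter, Finset.mem_Ico] at hj ⊢
      refine ⟨hj.1.1, ?_⟩
      by_contra hij
      exact hs ((P.τ_le_τ (not_lt.1 hij) hj.1.2.le).trans hj.2)
    have := Finset.card_le_card hsub
    simp only [Nat.card_Ico] at this
    omega
  · intro h
    have hsub : Finset.Icc 1 i ⊆ (Finset.Ico 1 P.k).filter (fun i => P.τ i ≤ s) := by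
      intro j hj
      simp only [Finset.mem_filter, Finset.mem_Ico, Finset.mem_Icc] at hj ⊢
      exact ⟨⟨hj.1, by omega⟩, (P.τ_le_τ hj.2 hik.le).trans h⟩
    have := Finset.card_le_card hsub
    simp only [Nat.card_Icc] at this
    omega

lemma τ_le_of_lt_level {i : ℕ} {s : ℝ} (hs : 0 ≤ s) (hi : i < P.level s) : P.τ i ≤ s := by
  rcases Nat.eq_zero_or_pos i with rfl | h
  · rwa [τ_zero]
  · exact (P.lt_level_iff h (hi.trans_le (P.level_le_k s)) s).1 hi

/-- Time spent under stress level `i` up to time `s`. -/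
def exposure (s : ℝ) (i : ℕ) : ℝ :=
  if i < P.level s then P.τ i - P.τ (i - 1)
  else if i = P.level s then s - P.τ (i - 1) else 0

lemma exposure_nonneg {s : ℝ} (hs : 0 ≤ s) (i : ℕ) : 0 ≤ P.exposure s i := by
  have := P.level_le_k s
  have := P.one_le_level s
  unfold exposure
  split_ifs with h1 h2
  · exact sub_nonneg.2 (P.τ_le_τ (by omega) (by omega))
  · exact sub_nonneg.2 (P.τ_le_of_lt_level hs (by omega))
  · exact le_rfl

lemma exposure_mono {s u : ℝ} (hs : 0 ≤ s) (hsu : s ≤ u) {i : ℕ} (hi : 1 ≤ i) :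
    P.exposure s i ≤ P.exposure u i := by
  have hk := P.level_le_k s
  have hk' := P.level_le_k u
  have hle : ∀ j, j < P.level s → j < P.level u := by
    intro j hj
    rcases Nat.eq_zero_or_pos j with rfl | h
    · exact P.one_le_level u
    · exact (P.lt_level_iff h (by omega) u).2 (((P.lt_level_iff h (by omega) s).1 hj).trans hsu)
  by_cases h1 : i < P.level s
  · simp [exposure, h1, hle i h1]
  by_cases h2 : i = P.level s
  · have h3 : ¬ i < P.level s := h1
    have h4 := hle (i - 1) (by omega)
    by_cases h5 : i < P.level u
    -- Level `i` is current at `s` and completed by `u`; its full duration exceeds the part elapsed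
    -- at `s`.
    · have : ¬ P.τ i ≤ s := fun h => h1 ((P.lt_level_iff hi (by omega) s).2 h)
      rw [exposure, if_neg h3, if_pos h2, exposure, if_pos h5]
      linarith
    · rw [exposure, if_neg h3, if_pos h2, exposure, if_neg h5, if_pos (by omega)]
      linarith
  · rw [exposure, if_neg h1, if_neg h2]
    exact P.exposure_nonneg (hs.trans hsu) i

lemma exposure_lt {s u : ℝ} (hsu : s < u) :
    P.exposure s (P.level s) < P.exposure u (P.level s) := by
  have hk := P.level_le_k s
  have hk' := P.level_le_k u
  have h0 := P.one_le_level s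
  have h0' := P.one_le_level u
  rw [exposure, if_neg (lt_irrefl _), if_pos rfl, exposure]
  split_ifs with h1 h2
  · have : ¬ P.τ (P.level s) ≤ s := fun h =>
      lt_irrefl _ ((P.lt_level_iff h0 (by omega) s).2 h)
    linarith
  · linarith
  · exfalso
    have h3 := (P.lt_level_iff h0' (by omega) s).1 (by omega)
    exact lt_irrefl _ ((P.lt_level_iff h0' (by omega) u).2 (h3.trans hsu.le))

lemma exposure_zero {i : ℕ} (hi : 1 ≤ i) : P.exposure 0 i = 0 := by
  have h1 : P.level 0 = 1 := by
    refine le_antisymm ?_ (P.one_le_level 0)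
    by_contra h
    have := P.two_le_k
    have h2 := (P.lt_level_iff le_rfl (by omega) 0).1 (not_le.1 h)
    have h3 := P.τ_lt_τ (i := 0) (j := 1) (by omega) (by omega)
    rw [τ_zero] at h3
    linarith
  rcases hi.lt_or_eq with h | rfl
  · rw [exposure, if_neg (by omega), if_neg (by omega)]
  · rw [exposure, if_neg (by omega), if_pos h1.symm]
    simp [τ_zero]

/-- A sum over the levels weighted by the exposure splits into the completed levels and the
current one. -/
lemma sum_exposure_mul (s : ℝ) (f : ℕ → ℝ) :
    ∑ i ∈ Finset.Icc 1 P.k, P.exposure s i * f i =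
      (∑ i ∈ Finset.Ico 1 (P.level s), (P.τ i - P.τ (i - 1)) * f i) +
        (s - P.τ (P.level s - 1)) * f (P.level s) := by
  have hk := P.level_le_k s
  have h0 := P.one_le_level s
  have hsub : Finset.Ico 1 (P.level s + 1) ⊆ Finset.Icc 1 P.k := by
    intro i hi
    simp only [Finset.mem_Ico, Finset.mem_Icc] at hi ⊢
    omega
  rw [← Finset.sum_subset hsub, Finset.sum_Ico_succ_top h0]
  · congr 1
    · refine Finset.sum_congr rfl fun i hi => ?_
      rw [exposure, if_pos (Finset.mem_Ico.1 hi).2]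
    · simp [exposure]
  · intro i _ hi
    simp only [Finset.mem_Ico, not_and, not_lt, Finset.mem_Icc] at *
    rw [exposure, if_neg (by omega), if_neg (by omega), zero_mul]

/-- Cumulative hazard at time `s`. -/
def cumHazard (θ : Param) (s : ℝ) : ℝ := ∑ i ∈ Finset.Icc 1 P.k, P.exposure s i * P.rate θ i

end StepStressPlan

lemma failureRate_pos {θ : Param} (hθ : θ ∈ paramSpace) (s : ℝ) : 0 < failureRate θ s :=
  mul_pos hθ (Real.exp_pos _)

namespace StepStressPlan

variable (P : StepStressPlan)

lemma rate_pos {θ : Param} (hθ : θ ∈ paramSpace) (i : ℕ) : 0 < P.rate θ i :=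
  failureRate_pos hθ _

/-- The shift is the time at the current rate that would accumulate the hazard of the completed
levels; multiplying by that rate recovers this hazard. -/
lemma rate_mul_age {θ : Param} (hθ : θ ∈ paramSpace) (s : ℝ) :
    P.rate θ (P.level s) * P.age θ s = P.cumHazard θ s := by
  have h := (P.rate_pos hθ (P.level s)).ne'
  rw [cumHazard, sum_exposure_mul, age, shift]
  field_simp
  ring

/-- The term `shiftStar` corrects the stress `x_i`, credited to the whole equivalent age, to the
stress actually applied in each earlier level. The result is the derivative of the hazard in `θ 1`.
-/
lemma rate_mul_age_slope {θ : Param} (hθ : θ ∈ paramSpace) (s : ℝ) :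
    P.rate θ (P.level s) * (P.age θ s * P.x (P.level s) + P.shiftStar θ (P.level s)) =
      ∑ i ∈ Finset.Icc 1 P.k, P.exposure s i * (P.rate θ i * P.x i) := by
  have h := (P.rate_pos hθ (P.level s)).ne'
  have h2 : P.rate θ (P.level s) * P.shiftStar θ (P.level s) =
      (∑ i ∈ Finset.Ico 1 (P.level s), (P.τ i - P.τ (i - 1)) * (P.rate θ i * P.x i)) -
      (∑ i ∈ Finset.Ico 1 (P.level s), (P.τ i - P.τ (i - 1)) * P.rate θ i) *
        P.x (P.level s) := by
    rw [shiftStar, ← mul_assoc, mul_one_div_cancel h, one_mul, Finset.sum_mul,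
      ← Finset.sum_sub_distrib]
    exact Finset.sum_congr rfl fun i _ => by ring
  rw [mul_add, h2, ← mul_assoc, P.rate_mul_age hθ, cumHazard, sum_exposure_mul, sum_exposure_mul]
  ring

lemma cumHazard_zero (θ : Param) : P.cumHazard θ 0 = 0 :=
  Finset.sum_eq_zero fun i hi => by
    rw [P.exposure_zero (Finset.mem_Icc.1 hi).1, zero_mul]

lemma cumHazard_lt {θ : Param} (hθ : θ ∈ paramSpace) {s u : ℝ} (hs : 0 ≤ s) (hsu : s < u) :
    P.cumHazard θ s < P.cumHazard θ u := by
  refine Finset.sum_lt_sum (fun i hi => ?_) ⟨P.level s, ?_, ?_⟩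
  · exact mul_le_mul_of_nonneg_right (P.exposure_mono hs hsu.le (Finset.mem_Icc.1 hi).1)
      (P.rate_pos hθ i).le
  · exact Finset.mem_Icc.2 ⟨P.one_le_level s, P.level_le_k s⟩
  · exact mul_lt_mul_of_pos_right (P.exposure_lt hsu) (P.rate_pos hθ _)

/-- At the first change of stress only the first level has been in force. -/
lemma sum_exposure_τ_one (f : ℕ → ℝ) :
    ∑ i ∈ Finset.Icc 1 P.k, P.exposure (P.τ 1) i * f i = P.τ 1 * f 1 := by
  have hk := P.two_le_k
  have h1 : P.level (P.τ 1) = 2 := by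
    have h2 := (P.lt_level_iff le_rfl (by omega) (P.τ 1)).2 le_rfl
    refine le_antisymm (not_lt.1 fun h => ?_) h2
    have hk' := P.level_le_k (P.τ 1)
    have := (P.lt_level_iff (i := 2) (by omega) (by omega) (P.τ 1)).1 h
    exact absurd (P.τ_lt_τ (i := 1) (j := 2) (by omega) (by omega)) (not_lt.2 this)
  rw [sum_exposure_mul, h1]
  simp [τ_zero]

/-- At the second change of stress the first two levels have been in force. -/
lemma sum_exposure_τ_two (f : ℕ → ℝ) :
    ∑ i ∈ Finset.Icc 1 P.k, P.exposure (P.τ 2) i * f i =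
      P.τ 1 * f 1 + (P.τ 2 - P.τ 1) * f 2 := by
  have hk := P.two_le_k
  have hk' := P.level_le_k (P.τ 2)
  have h12 := P.τ_lt_τ (i := 1) (j := 2) (by omega) (by omega)
  have h1 := (P.lt_level_iff le_rfl (by omega) (P.τ 2)).2 h12.le
  have h3 : P.level (P.τ 2) ≤ 3 := by
    refine not_lt.1 fun h => ?_
    have := (P.lt_level_iff (i := 3) (by omega) (by omega) (P.τ 2)).1 h
    exact absurd (P.τ_lt_τ (i := 2) (j := 3) (by omega) (by omega)) (not_lt.2 this)
  -- The level stays `2` when `k = 2`, because the last level has no end.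
  have h4 : P.level (P.τ 2) = 2 ∨ P.level (P.τ 2) = 3 := by omega
  rw [sum_exposure_mul]
  rcases h4 with h4 | h4 <;> rw [h4]
  · simp [τ_zero]
  · simp [τ_zero, Finset.sum_Ico_succ_top]

/-! ### Cell probabilities as differences of survival probabilities -/

/-- Probability to survive the `n`-th inspection; `0` beyond the last one. -/
def survival (θ : Param) (n : ℕ) : ℝ :=
  if n ≤ P.L then Real.exp (-P.cumHazard θ (P.t n)) else 0

lemma survival_zero (θ : Param) : P.survival θ 0 = 1 := by
  simp [survival, P.t_zero, cumHazard_zero]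

lemma lifetimeCDF_eq {θ : Param} (hθ : θ ∈ paramSpace) {s : ℝ} (hs : 0 ≤ s) :
    P.lifetimeCDF θ s = 1 - Real.exp (-P.cumHazard θ s) := by
  rw [lifetimeCDF, if_neg (not_lt.2 hs), P.rate_mul_age hθ]

lemma cellProb_eq {θ : Param} (hθ : θ ∈ paramSpace) (j : Fin (P.L + 1)) :
    P.cellProb θ j = P.survival θ j - P.survival θ (j + 1) := by
  have hj := j.2
  unfold cellProb
  split_ifs with h
  · rw [P.lifetimeCDF_eq hθ (P.t_nonneg (by omega)), P.lifetimeCDF_eq hθ (P.t_nonneg (by omega)),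
      survival, survival, if_pos (by omega), if_pos (by omega)]
    ring
  · have h' : (j : ℕ) = P.L := by omega
    rw [P.lifetimeCDF_eq hθ (P.t_nonneg le_rfl), survival, survival, h', if_pos le_rfl,
      if_neg (by omega)]
    ring

lemma cellProb_pos {θ : Param} (hθ : θ ∈ paramSpace) (j : Fin (P.L + 1)) :
    0 < P.cellProb θ j := by
  have hj := j.2
  rw [P.cellProb_eq hθ, survival, if_pos (by omega), survival]
  split_ifs with h
  · rw [sub_pos, Real.exp_lt_exp, neg_lt_neg_iff]
    exact P.cumHazard_lt hθ (P.t_nonneg (by omega)) (P.t_lt_t (by omega) h)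
  · rw [sub_zero]
    exact Real.exp_pos _

lemma sum_cellProb {θ : Param} (hθ : θ ∈ paramSpace) : ∑ j, P.cellProb θ j = 1 := by
  simp_rw [P.cellProb_eq hθ]
  rw [Fin.sum_univ_eq_sum_range (fun j => P.survival θ j - P.survival θ (j + 1)),
    Finset.sum_range_sub', survival_zero, survival, if_neg (by omega), sub_zero]

lemma survival_eq_one_sub {θ : Param} (hθ : θ ∈ paramSpace) {n : ℕ} (hn : n ≤ P.L) :
    P.survival θ n =
      1 - ∑ j ∈ Finset.univ.filter (fun j : Fin (P.L + 1) => (j : ℕ) < n), P.cellProb θ j := by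
  simp_rw [P.cellProb_eq hθ]
  rw [Finset.sum_filter, Fin.sum_univ_eq_sum_range
    (fun j => if j < n then P.survival θ j - P.survival θ (j + 1) else 0), ← Finset.sum_filter]
  have : (Finset.range (P.L + 1)).filter (· < n) = Finset.range n := by
    ext j
    simp only [Finset.mem_filter, Finset.mem_range]
    omega
  rw [this, Finset.sum_range_sub', survival_zero]
  ring

end StepStressPlan

/-! ### `W` as the Jacobian of the cell probabilities -/

/-- The linear functional on the parameters with the given coefficients. -/
def paramFunctional (v : Fin 2 → ℝ) : Param →L[ℝ] ℝ :=
  v 0 • EuclideanSpace.proj (0 : Fin 2) + v 1 • EuclideanSpace.proj (1 : Fin 2)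

lemma paramFunctional_apply (v : Fin 2 → ℝ) (h : Param) :
    paramFunctional v h = v ⬝ᵥ h.ofLp := by
  simp [paramFunctional, dotProduct, Fin.sum_univ_two]

lemma paramFunctional_sub (v w : Fin 2 → ℝ) :
    paramFunctional (v - w) = paramFunctional v - paramFunctional w := by
  ext h
  simp [paramFunctional_apply, sub_dotProduct]

lemma paramFunctional_smul (c : ℝ) (v : Fin 2 → ℝ) :
    paramFunctional (c • v) = c • paramFunctional v := by
  ext h
  simp [paramFunctional_apply]

lemma paramFunctional_sum {ι : Type*} (s : Finset ι) (v : ι → Fin 2 → ℝ) :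
    paramFunctional (∑ i ∈ s, v i) = ∑ i ∈ s, paramFunctional (v i) := by
  ext h
  simp [paramFunctional_apply, sum_dotProduct]

lemma isOpen_paramSpace : IsOpen paramSpace :=
  isOpen_lt continuous_const (by fun_prop)

lemma hasFDerivAt_failureRate {θ : Param} (hθ : θ ∈ paramSpace) (s : ℝ) :
    HasFDerivAt (fun θ => failureRate θ s)
      (paramFunctional (failureRate θ s • ![1 / θ 0, s])) θ := by
  have h0 : HasFDerivAt (fun θ : Param => θ 0) (EuclideanSpace.proj (𝕜 := ℝ) (0 : Fin 2)) θ :=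
    (EuclideanSpace.proj (𝕜 := ℝ) (0 : Fin 2)).hasFDerivAt
  have h1 : HasFDerivAt (fun θ : Param => θ 1) (EuclideanSpace.proj (𝕜 := ℝ) (1 : Fin 2)) θ :=
    (EuclideanSpace.proj (𝕜 := ℝ) (1 : Fin 2)).hasFDerivAt
  have hne : θ 0 ≠ 0 := ne_of_gt hθ
  refine (h0.mul (h1.mul_const s).exp).congr_fderiv ?_
  ext h
  simp [paramFunctional, failureRate]
  field_simp
  ring

lemma tendsto_param {ι : Type*} {l : Filter ι} {u : ι → Param} {θ : Param}
    (h : ∀ c : Fin 2, Tendsto (fun a => u a c) l (𝓝 (θ c))) : Tendsto u l (𝓝 θ) := by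
  have h2 : Tendsto (fun a => (u a).ofLp) l (𝓝 θ.ofLp) := tendsto_pi_nhds.2 h
  exact ((PiLp.continuous_toLp 2 (fun _ : Fin 2 => ℝ)).tendsto _).comp h2

namespace StepStressPlan

variable (P : StepStressPlan)

/-- This is survival times the gradient of the hazard. The conventions at both ends fit: the
exposure vanishes at time `0`, and `survival` vanishes beyond `L`. -/
lemma z_eq {θ : Param} (hθ : θ ∈ paramSpace) (n : ℕ) :
    P.z θ n = P.survival θ n •
      ∑ i ∈ Finset.Icc 1 P.k, (P.exposure (P.t n) i * P.rate θ i) • ![1 / θ 0, P.x i] := by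
  unfold z survival
  by_cases hn : n ≤ P.L
  · by_cases h0 : n = 0
    · rw [if_pos (Or.inl h0), Finset.sum_eq_zero, smul_zero]
      intro i hi
      rw [h0, P.t_zero, P.exposure_zero (Finset.mem_Icc.1 hi).1, zero_mul, zero_smul]
    · have ht := P.t_nonneg hn
      rw [if_neg (by omega), if_pos hn, lifetimePDF, if_neg (not_lt.2 ht), P.rate_mul_age hθ]
      have e1 := P.rate_mul_age hθ (P.t n)
      have e2 := P.rate_mul_age_slope hθ (P.t n)
      rw [mul_comm, mul_smul]
      congr 1
      ext c
      fin_cases c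
      · simp [Finset.sum_apply, ← Finset.sum_mul]
        rw [cumHazard] at e1
        rw [← e1]
        ring
      · simp [Finset.sum_apply]
        rw [e2]
        exact Finset.sum_congr rfl fun i _ => by ring
  · rw [if_pos (by omega), if_neg hn, zero_smul]

lemma hasFDerivAt_cumHazard {θ : Param} (hθ : θ ∈ paramSpace) (s : ℝ) :
    HasFDerivAt (fun θ => P.cumHazard θ s) (paramFunctional
      (∑ i ∈ Finset.Icc 1 P.k, (P.exposure s i * P.rate θ i) • ![1 / θ 0, P.x i])) θ := by
  have h := HasFDerivAt.fun_sum (u := Finset.Icc 1 P.k)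
    (fun i _ => (hasFDerivAt_failureRate hθ (P.x i)).const_mul (P.exposure s i))
  refine h.congr_fderiv ?_
  rw [paramFunctional_sum]
  refine Finset.sum_congr rfl fun i _ => ?_
  rw [mul_smul, paramFunctional_smul (P.exposure s i)]
  rfl

lemma hasFDerivAt_survival {θ : Param} (hθ : θ ∈ paramSpace) (n : ℕ) :
    HasFDerivAt (fun θ => P.survival θ n) (-paramFunctional (P.z θ n)) θ := by
  rw [P.z_eq hθ, paramFunctional_smul]
  unfold survival
  split_ifs with hn
  · refine (P.hasFDerivAt_cumHazard hθ (P.t n)).neg.exp.congr_fderiv ?_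
    rw [smul_neg]
    rfl
  · simpa using hasFDerivAt_const (0 : ℝ) θ

lemma hasFDerivAt_cellProb {θ : Param} (hθ : θ ∈ paramSpace) (j : Fin (P.L + 1)) :
    HasFDerivAt (fun θ => P.cellProb θ j) (paramFunctional (P.W θ j)) θ := by
  have h := (P.hasFDerivAt_survival hθ j).fun_sub (P.hasFDerivAt_survival hθ (j + 1))
  have e : (fun θ => P.cellProb θ j) =ᶠ[𝓝 θ]
      fun θ => P.survival θ j - P.survival θ (j + 1) := by
    filter_upwards [isOpen_paramSpace.mem_nhds hθ] with θ' hθ'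
    exact P.cellProb_eq hθ' j
  refine (h.congr_of_eventuallyEq e).congr_fderiv ?_
  have : P.W θ j = P.z θ (j + 1) - P.z θ j := rfl
  rw [this, paramFunctional_sub]
  abel

lemma continuousAt_cellProb {θ : Param} (hθ : θ ∈ paramSpace) (j : Fin (P.L + 1)) :
    ContinuousAt (fun θ => P.cellProb θ j) θ := (P.hasFDerivAt_cellProb hθ j).continuousAt

lemma continuousAt_z {θ : Param} (hθ : θ ∈ paramSpace) (n : ℕ) (c : Fin 2) :
    ContinuousAt (fun θ => P.z θ n c) θ := by
  have e : (fun θ => P.z θ n c) =ᶠ[𝓝 θ] fun θ => P.survival θ n *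
      ∑ i ∈ Finset.Icc 1 P.k, (P.exposure (P.t n) i * P.rate θ i) * ![1 / θ 0, P.x i] c := by
    filter_upwards [isOpen_paramSpace.mem_nhds hθ] with θ' hθ'
    rw [P.z_eq hθ', Pi.smul_apply, Finset.sum_apply]
    rfl
  have hne : θ 0 ≠ 0 := ne_of_gt hθ
  refine ContinuousAt.congr ?_ e.symm
  refine (P.hasFDerivAt_survival hθ n).continuousAt.mul ?_
  refine tendsto_finsetSum _ fun i _ => ?_
  refine ((hasFDerivAt_failureRate hθ (P.x i)).continuousAt.const_mul _).mul ?_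
  have h0 : ContinuousAt (fun θ : Param => θ 0) θ := by fun_prop
  fin_cases c
  · exact continuousAt_const.div h0 hne
  · exact continuousAt_const

lemma continuousAt_W {θ : Param} (hθ : θ ∈ paramSpace) (j : Fin (P.L + 1)) (c : Fin 2) :
    ContinuousAt (fun θ => P.W θ j c) θ :=
  (P.continuousAt_z hθ (j + 1) c).sub (P.continuousAt_z hθ j c)

/-- The rows telescope between two zero vectors, as they must for probabilities of constant sum. -/
lemma sum_W (θ : Param) (c : Fin 2) : ∑ j, P.W θ j c = 0 := by
  have h : ∀ j : Fin (P.L + 1), P.W θ j c = P.z θ (j + 1) c - P.z θ j c := fun _ => rfl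
  simp_rw [h]
  rw [Fin.sum_univ_eq_sum_range (fun j => P.z θ (j + 1) c - P.z θ j c),
    Finset.sum_range_sub (fun j => P.z θ j c)]
  simp [z]

/-! ### Identifiability of the parameter -/

lemma x_one_lt_x_two : P.x 1 < P.x 2 := by
  have := P.two_le_k
  exact P.x_strictMono ⟨le_rfl, by omega⟩ ⟨by omega, this⟩ (by omega)

/-- The Jacobian of the cell probabilities is injective. -/
lemma eq_zero_of_W_mulVec {θ : Param} (hθ : θ ∈ paramSpace) {v : Fin 2 → ℝ}
    (hv : P.W θ *ᵥ v = 0) : v = 0 := by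
  have hk := P.two_le_k
  have hz : ∀ n, n ≤ P.L → P.z θ n ⬝ᵥ v = 0 := by
    intro n
    induction n with
    | zero => intro _; simp [z]
    | succ n ih =>
      intro hn
      have h : (P.z θ (n + 1) - P.z θ n) ⬝ᵥ v = 0 := congrFun hv ⟨n, by omega⟩
      rw [sub_dotProduct, ih (by omega), sub_zero] at h
      exact h
  -- After division by the positive survival probability, `v` annihilates the hazard gradient at
  -- each `τ i`. The cases `i = 1, 2` isolate the first two levels, and `x 1 < x 2` makes the two
  -- equations independent.
  have key : ∀ i, i ≤ P.k → (∑ m ∈ Finset.Icc 1 P.k, P.exposure (P.τ i) m *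
      (P.rate θ m * (v 0 / θ 0 + P.x m * v 1))) = 0 := by
    intro i hi
    have h := hz (P.l i) (P.l_le_L hi)
    rw [P.z_eq hθ, smul_dotProduct, sum_dotProduct, smul_eq_mul, survival,
      if_pos (P.l_le_L hi)] at h
    rw [← (mul_eq_zero.1 h).resolve_left (Real.exp_pos _).ne']
    refine Finset.sum_congr rfl fun m _ => ?_
    simp [dotProduct, Fin.sum_univ_two, τ]
    ring
  have h01 := P.τ_lt_τ (i := 0) (j := 1) (by omega) (by omega)
  rw [τ_zero] at h01
  have h12 := P.τ_lt_τ (i := 1) (j := 2) (by omega) (by omega)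
  have k1 := key 1 (by omega)
  rw [sum_exposure_τ_one] at k1
  have k2 := key 2 (by omega)
  rw [sum_exposure_τ_two, k1, zero_add] at k2
  have e1 := (mul_eq_zero.1 ((mul_eq_zero.1 k1).resolve_left h01.ne')).resolve_left
    (P.rate_pos hθ 1).ne'
  have e2 := (mul_eq_zero.1 ((mul_eq_zero.1 k2).resolve_left (by linarith))).resolve_left
    (P.rate_pos hθ 2).ne'
  have e3 : (P.x 2 - P.x 1) * v 1 = 0 := by linarith
  have v1 : v 1 = 0 := (mul_eq_zero.1 e3).resolve_left (sub_pos.2 P.x_one_lt_x_two).ne'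
  rw [v1, mul_zero, add_zero] at e1
  have hne : θ 0 ≠ 0 := ne_of_gt hθ
  have v0 : v 0 = 0 := by simpa [hne] using e1
  ext c
  fin_cases c
  · exact v0
  · exact v1

lemma log_rate {θ : Param} (hθ : θ ∈ paramSpace) (i : ℕ) :
    Real.log (P.rate θ i) = Real.log (θ 0) + θ 1 * P.x i := by
  rw [rate, failureRate, Real.log_mul (ne_of_gt hθ) (Real.exp_pos _).ne', Real.log_exp]

/-- The parameter depends continuously on the cell probabilities. -/
lemma tendsto_of_tendsto_cellProb {ι : Type*} {l : Filter ι} {u : ι → Param}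
    {θ : Param} (hθ : θ ∈ paramSpace) (hu : ∀ᶠ a in l, u a ∈ paramSpace)
    (h : ∀ j, Tendsto (fun a => P.cellProb (u a) j) l (𝓝 (P.cellProb θ j))) :
    Tendsto u l (𝓝 θ) := by
  have hk := P.two_le_k
  -- Inversion chain: cell probabilities, survival, hazard at `τ 1` and `τ 2`, the rates `λ_1` and
  -- `λ_2`, and finally `θ`, since `log λ_i` is affine in `x i` with slope `θ 1`.
  have hH : ∀ i, i ≤ P.k →
      Tendsto (fun a => P.cumHazard (u a) (P.τ i)) l (𝓝 (P.cumHazard θ (P.τ i))) := by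
    intro i hi
    have e : ∀ θ' : Param, P.cumHazard θ' (P.τ i) = -Real.log (P.survival θ' (P.l i)) := by
      intro θ'
      rw [survival, if_pos (P.l_le_L hi), Real.log_exp, neg_neg, τ]
    simp_rw [e]
    have hS : Tendsto (fun a => P.survival (u a) (P.l i)) l (𝓝 (P.survival θ (P.l i))) := by
      rw [P.survival_eq_one_sub hθ (P.l_le_L hi)]
      refine (tendsto_const_nhds.sub (tendsto_finsetSum _ fun j _ => h j)).congr' ?_
      filter_upwards [hu] with a ha
      rw [P.survival_eq_one_sub ha (P.l_le_L hi)]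
    refine (hS.log ?_).neg
    rw [survival, if_pos (P.l_le_L hi)]
    exact (Real.exp_pos _).ne'
  have h01 := P.τ_lt_τ (i := 0) (j := 1) (by omega) (by omega)
  rw [τ_zero] at h01
  have h12 := sub_pos.2 (P.τ_lt_τ (i := 1) (j := 2) (by omega) (by omega))
  have r1 : Tendsto (fun a => P.rate (u a) 1) l (𝓝 (P.rate θ 1)) := by
    have e : ∀ θ' : Param, P.rate θ' 1 = P.cumHazard θ' (P.τ 1) / P.τ 1 := by
      intro θ'
      rw [cumHazard, sum_exposure_τ_one]
      field_simp
    simp_rw [e]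
    exact (hH 1 (by omega)).div_const _
  have r2 : Tendsto (fun a => P.rate (u a) 2) l (𝓝 (P.rate θ 2)) := by
    have e : ∀ θ' : Param, P.rate θ' 2 =
        (P.cumHazard θ' (P.τ 2) - P.cumHazard θ' (P.τ 1)) / (P.τ 2 - P.τ 1) := by
      intro θ'
      rw [cumHazard, cumHazard, sum_exposure_τ_one, sum_exposure_τ_two]
      field_simp
      ring
    simp_rw [e]
    exact ((hH 2 (by omega)).sub (hH 1 (by omega))).div_const _
  have L1 := r1.log (P.rate_pos hθ 1).ne'
  have L2 := r2.log (P.rate_pos hθ 2).ne'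
  have hx := sub_pos.2 P.x_one_lt_x_two
  have hθ1 : Tendsto (fun a => u a 1) l (𝓝 (θ 1)) := by
    have e : ∀ θ' ∈ paramSpace, θ' 1 =
        (Real.log (P.rate θ' 2) - Real.log (P.rate θ' 1)) / (P.x 2 - P.x 1) := by
      intro θ' hθ'
      rw [P.log_rate hθ', P.log_rate hθ']
      field_simp
      ring
    rw [e θ hθ]
    refine ((L2.sub L1).div_const _).congr' ?_
    filter_upwards [hu] with a ha
    exact (e _ ha).symm
  have hθ0 : Tendsto (fun a => u a 0) l (𝓝 (θ 0)) := by
    have e : ∀ θ' ∈ paramSpace, θ' 0 = P.rate θ' 1 * Real.exp (-(θ' 1 * P.x 1)) := by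
      intro θ' _
      rw [rate, failureRate, mul_assoc, ← Real.exp_add]
      simp
    rw [e θ hθ]
    refine (r1.mul ((hθ1.mul_const (P.x 1)).neg.rexp)).congr' ?_
    filter_upwards [hu] with a ha
    exact (e _ ha).symm
  refine tendsto_param fun c => ?_
  fin_cases c
  · exact hθ0
  · exact hθ1

end StepStressPlan

/-! ### Lower bounds for the divergence and consistency -/

/-- A jointly continuous lower bound, summand by summand, of the density power divergence: the
summand itself for `β > 0`, and that of the squared Hellinger distance for `β = 0`. -/
def dpdMinorant (β p q : ℝ) : ℝ :=
  if β = 0 then (√p - √q) ^ 2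
  else q ^ (1 + β) - (1 + 1 / β) * p * q ^ β + (1 / β) * p ^ (β + 1)

lemma continuous_dpdMinorant {β : ℝ} (hβ : 0 ≤ β) :
    Continuous fun x : ℝ × ℝ => dpdMinorant β x.1 x.2 := by
  unfold dpdMinorant
  split_ifs with h
  · fun_prop
  · have h1 := Real.continuous_rpow_const (q := 1 + β) (by linarith)
    have h2 := Real.continuous_rpow_const (q := β + 1) (by linarith)
    have h3 := Real.continuous_rpow_const hβ
    exact ((h1.comp continuous_snd).sub ((continuous_const.mul continuous_fst).mul
      (h3.comp continuous_snd))).add (continuous_const.mul (h2.comp continuous_fst))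

lemma dpdMinorant_self {β p : ℝ} (hβ : 0 ≤ β) (hp : 0 ≤ p) : dpdMinorant β p p = 0 := by
  unfold dpdMinorant
  split_ifs with h
  · simp
  · have hβ' : 0 < β := lt_of_le_of_ne hβ (Ne.symm h)
    rw [add_comm 1 β, Real.rpow_add_one' hp (by linarith)]
    field_simp
    ring

lemma dpdMinorant_pos {β p q : ℝ} (hβ : 0 ≤ β) (hp : 0 ≤ p) (hq : 0 ≤ q) (hpq : p ≠ q) :
    0 < dpdMinorant β p q := by
  unfold dpdMinorant
  split_ifs with h
  · have : √p - √q ≠ 0 := sub_ne_zero.2 fun e => hpq ((Real.sqrt_inj hp hq).1 e)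
    positivity
  · have hβ' : 0 < β := lt_of_le_of_ne hβ (Ne.symm h)
    rcases hq.eq_or_lt with rfl | hq'
    · have hp' : 0 < p := lt_of_le_of_ne hp (Ne.symm hpq)
      rw [Real.zero_rpow (by linarith), Real.zero_rpow h]
      have := Real.rpow_pos_of_pos hp' (β + 1)
      simp only [mul_zero, sub_zero, zero_add]
      positivity
    · have hne : p / q - 1 ≠ 0 := by
        rw [sub_ne_zero]
        intro e
        exact hpq ((div_eq_one_iff_eq hq'.ne').1 e)
      -- Strict Bernoulli inequality for `(p / q) ^ (β + 1)`; multiplied by `q ^ (β + 1)` and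
      -- divided by `β` it is the claim.
      have hb := one_add_mul_self_lt_rpow_one_add (s := p / q - 1)
        (by have := div_nonneg hp hq; linarith) hne (p := β + 1) (by linarith)
      rw [add_sub_cancel, Real.div_rpow hp hq] at hb
      have hpow := Real.rpow_pos_of_pos hq' (β + 1)
      have hb2 := mul_lt_mul_of_pos_right hb hpow
      rw [div_mul_cancel₀ _ hpow.ne'] at hb2
      have e1 : q ^ (1 + β) = q ^ β * q := by rw [add_comm, Real.rpow_add_one hq'.ne']
      have e2 : q ^ (β + 1) = q ^ β * q := Real.rpow_add_one hq'.ne' β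
      rw [e2] at hb2
      rw [e1]
      have e3 : (1 + (β + 1) * (p / q - 1)) * (q ^ β * q) =
          (β + 1) * p * q ^ β - β * (q ^ β * q) := by
        field_simp
        ring
      rw [e3] at hb2
      have e4 : q ^ β * q - (1 + 1 / β) * p * q ^ β + 1 / β * p ^ (β + 1) =
          (p ^ (β + 1) - ((β + 1) * p * q ^ β - β * (q ^ β * q))) / β := by
        field_simp
        ring
      rw [e4]
      exact div_pos (by linarith) hβ'

lemma dpdMinorant_nonneg {β p q : ℝ} (hβ : 0 ≤ β) (hp : 0 ≤ p) (hq : 0 ≤ q) :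
    0 ≤ dpdMinorant β p q := by
  rcases eq_or_ne p q with rfl | h
  · exact (dpdMinorant_self hβ hp).ge
  · exact (dpdMinorant_pos hβ hp hq h).le

/-- Compactness of the unit square: at any cluster point of `(p, q)` the first coordinate is `p₀`
and the continuous minorant vanishes, which forces the diagonal. -/
lemma tendsto_of_dpdMinorant {ι : Type*} {l : Filter ι} {β : ℝ} (hβ : 0 ≤ β) {p q : ι → ℝ}
    {p₀ : ℝ} (hp : Tendsto p l (𝓝 p₀)) (hp0 : ∀ᶠ a in l, p a ∈ Set.Icc (0 : ℝ) 1)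
    (hq : ∀ᶠ a in l, q a ∈ Set.Icc (0 : ℝ) 1)
    (h : Tendsto (fun a => dpdMinorant β (p a) (q a)) l (𝓝 0)) : Tendsto q l (𝓝 p₀) := by
  have hc : Tendsto (fun a => (p a, q a)) l (𝓝 (p₀, p₀)) := by
    refine (isCompact_Icc (a := (0 : ℝ)) (b := 1) |>.prod
      (isCompact_Icc (a := (0 : ℝ)) (b := 1))).tendsto_nhds_of_unique_mapClusterPt ?_ ?_
    · filter_upwards [hp0, hq] with a h1 h2 using ⟨h1, h2⟩
    · rintro ⟨y1, y2⟩ ⟨hy1, hy2⟩ hy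
      obtain ⟨U, hU, hUy⟩ := mapClusterPt_iff_ultrafilter.1 hy
      have h1 : y1 = p₀ := tendsto_nhds_unique
        ((continuous_fst.tendsto _).comp hUy) (hp.mono_left hU)
      have h2 : dpdMinorant β y1 y2 = 0 := tendsto_nhds_unique
        (((continuous_dpdMinorant hβ).tendsto (y1, y2)).comp hUy) (h.mono_left hU)
      have h3 : y1 = y2 := by
        by_contra hne
        exact (dpdMinorant_pos hβ hy1.1 hy2.1 hne).ne' h2
      rw [← h3, h1]
  exact (continuous_snd.tendsto _).comp hc

/-- The left side equals `2p - 2√(pq)`, so this is `log y ≤ y - 1` at `y = √(q / p)`. The extra term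
`p - q` cancels on summing over probability vectors. -/
lemma sq_sqrt_sub_sqrt_le {p q : ℝ} (hp : 0 ≤ p) (hq : 0 < q) :
    (√p - √q) ^ 2 + (p - q) ≤ p * Real.log (p / q) := by
  rcases hp.eq_or_lt with rfl | hp'
  · simp [Real.sq_sqrt hq.le]
  · have h1 := Real.log_le_sub_one_of_pos (x := √(q / p)) (by positivity)
    rw [Real.log_sqrt (by positivity), Real.log_div hq.ne' hp'.ne'] at h1
    rw [Real.log_div hp'.ne' hq.ne']
    have h2 : p * √(q / p) = √p * √q := by
      rw [Real.sqrt_div hq.le]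
      nth_rewrite 1 [← Real.mul_self_sqrt hp]
      have := (Real.sqrt_pos.2 hp').ne'
      field_simp
    have h3 := Real.sq_sqrt hp
    have h4 := Real.sq_sqrt hq.le
    nlinarith [mul_le_mul_of_nonneg_left h1 hp]

namespace StepStressPlan

variable (P : StepStressPlan)

lemma cellProb_mem_stdSimplex {θ : Param} (hθ : θ ∈ paramSpace) :
    P.cellProb θ ∈ stdSimplex ℝ (Fin (P.L + 1)) :=
  ⟨fun j => (P.cellProb_pos hθ j).le, P.sum_cellProb hθ⟩

lemma sum_dpdMinorant_le_dpd {β : ℝ} {p q : Fin (P.L + 1) → ℝ} (hp : p ∈ stdSimplex ℝ _)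
    (hq : q ∈ stdSimplex ℝ _) (hq' : ∀ j, 0 < q j) :
    ∑ j, dpdMinorant β (p j) (q j) ≤ P.dpd β p q := by
  unfold dpdMinorant dpd
  split_ifs with h
  · have : ∑ j, (√(p j) - √(q j)) ^ 2 = ∑ j, ((√(p j) - √(q j)) ^ 2 + (p j - q j)) := by
      rw [Finset.sum_add_distrib, Finset.sum_sub_distrib, hp.2, hq.2]
      ring
    rw [this]
    exact Finset.sum_le_sum fun j _ => sq_sqrt_sub_sqrt_le (hp.1 j) (hq' j)
  · exact le_rfl

lemma tendsto_dpd_nhds_zero {β : ℝ} (hβ : 0 ≤ β) {q : Fin (P.L + 1) → ℝ} (hq : ∀ j, 0 < q j) :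
    Tendsto (fun p => P.dpd β p q) (𝓝 q) (𝓝 0) := by
  have hj : ∀ j, Tendsto (fun p : Fin (P.L + 1) → ℝ => p j) (𝓝 q) (𝓝 (q j)) := fun j =>
    (continuous_apply j).tendsto q
  unfold dpd
  split_ifs with h
  · have : ∀ j, Tendsto (fun p : Fin (P.L + 1) → ℝ => p j * Real.log (p j / q j)) (𝓝 q)
        (𝓝 (q j * Real.log (q j / q j))) := fun j =>
      (hj j).mul (((hj j).div_const _).log (by rw [div_self (hq j).ne']; exact one_ne_zero))
    have h2 := tendsto_finsetSum Finset.univ fun j _ => this j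
    have h3 : ∑ j, q j * Real.log (q j / q j) = 0 :=
      Finset.sum_eq_zero fun j _ => by rw [div_self (hq j).ne', Real.log_one, mul_zero]
    rwa [h3] at h2
  · have : ∀ j, Tendsto (fun p : Fin (P.L + 1) → ℝ => dpdMinorant β (p j) (q j)) (𝓝 q)
        (𝓝 (dpdMinorant β (q j) (q j))) := by
      intro j
      have hc : Continuous fun p : Fin (P.L + 1) → ℝ => dpdMinorant β (p j) (q j) :=
        Continuous.comp (f := fun p : Fin (P.L + 1) → ℝ => (p j, q j))
          (continuous_dpdMinorant hβ) (by fun_prop)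
      exact hc.tendsto q
    have h2 := tendsto_finsetSum Finset.univ fun j _ => this j
    have h3 : ∑ j, dpdMinorant β (q j) (q j) = 0 :=
      Finset.sum_eq_zero fun j _ => dpdMinorant_self hβ (hq j).le
    rw [h3] at h2
    simpa only [dpdMinorant, if_neg h] using h2

/-- Parameters which fit probability vectors near the model vector at `θ₀` at least as well as
`θ₀` does converge to `θ₀`. -/
lemma tendsto_of_dpd_le {ι : Type*} {l : Filter ι} {β : ℝ} (hβ : 0 ≤ β) {θ₀ : Param}
    (hθ₀ : θ₀ ∈ paramSpace) {p : ι → Fin (P.L + 1) → ℝ} {u : ι → Param}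
    (hp : Tendsto p l (𝓝 (P.cellProb θ₀))) (hpS : ∀ᶠ a in l, p a ∈ stdSimplex ℝ _)
    (hu : ∀ᶠ a in l, u a ∈ paramSpace)
    (hle : ∀ᶠ a in l, P.dpd β (p a) (P.cellProb (u a)) ≤ P.dpd β (p a) (P.cellProb θ₀)) :
    Tendsto u l (𝓝 θ₀) := by
  refine P.tendsto_of_tendsto_cellProb hθ₀ hu fun j => ?_
  refine tendsto_of_dpdMinorant hβ (tendsto_pi_nhds.1 hp j)
    (hpS.mono fun a ha => mem_Icc_of_mem_stdSimplex ha j)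
    (hu.mono fun a ha => mem_Icc_of_mem_stdSimplex (P.cellProb_mem_stdSimplex ha) j) ?_
  refine squeeze_zero' (g := fun a => P.dpd β (p a) (P.cellProb θ₀)) ?_ ?_
    ((P.tendsto_dpd_nhds_zero hβ (P.cellProb_pos hθ₀)).comp hp)
  · filter_upwards [hpS, hu] with a h1 h2
    exact dpdMinorant_nonneg hβ (h1.1 j) (P.cellProb_pos h2 j).le
  · filter_upwards [hpS, hu, hle] with a h1 h2 h3
    refine le_trans ?_ h3
    refine le_trans ?_ (P.sum_dpdMinorant_le_dpd h1 (P.cellProb_mem_stdSimplex h2)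
      (P.cellProb_pos h2))
    exact Finset.single_le_sum (f := fun j => dpdMinorant β (p a j) (P.cellProb (u a) j))
      (fun i _ => dpdMinorant_nonneg hβ (h1.1 i) (P.cellProb_pos h2 i).le) (Finset.mem_univ j)

/-! ### The estimating equation and existence of minimizers -/

/-- The matrix `Wᵀ D^{β-1}`. -/
def scoreMatrix (β : ℝ) (θ : Param) : Matrix (Fin 2) (Fin (P.L + 1)) ℝ :=
  (P.W θ)ᵀ * Matrix.diagonal (fun j => P.cellProb θ j ^ (β - 1))

lemma scoreMatrix_apply (β : ℝ) (θ : Param) (c : Fin 2) (j : Fin (P.L + 1)) :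
    P.scoreMatrix β θ c j = P.W θ j c * P.cellProb θ j ^ (β - 1) := by
  rw [scoreMatrix, Matrix.mul_diagonal, Matrix.transpose_apply]

lemma J_eq (β : ℝ) (θ : Param) : P.J β θ = P.scoreMatrix β θ * P.W θ := rfl

lemma continuousAt_scoreMatrix (β : ℝ) {θ : Param} (hθ : θ ∈ paramSpace) (c : Fin 2)
    (j : Fin (P.L + 1)) : ContinuousAt (fun θ => P.scoreMatrix β θ c j) θ := by
  simp_rw [scoreMatrix_apply]
  exact (P.continuousAt_W hθ j c).mul ((P.continuousAt_cellProb hθ j).rpow_const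
    (Or.inl (P.cellProb_pos hθ j).ne'))

lemma hasDerivAt_dpd_summand {β : ℝ} (hβ : β ≠ 0) (p : ℝ) {q : ℝ} (hq : 0 < q) :
    HasDerivAt (fun q => q ^ (1 + β) - (1 + 1 / β) * p * q ^ β + (1 / β) * p ^ (β + 1))
      ((1 + β) * (q ^ (β - 1) * (q - p))) q := by
  have h1 := Real.hasDerivAt_rpow_const (x := q) (p := 1 + β) (Or.inl hq.ne')
  have h2 := (Real.hasDerivAt_rpow_const (x := q) (p := β) (Or.inl hq.ne')).const_mul
    ((1 + 1 / β) * p)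
  refine ((h1.sub h2).add_const _).congr_deriv ?_
  have e : q ^ (1 + β - 1) = q ^ (β - 1) * q := by
    rw [← Real.rpow_add_one hq.ne']
    congr 1
    ring
  rw [e]
  field_simp
  ring

lemma hasDerivAt_mul_log_div (p : ℝ) {q : ℝ} (hq : 0 < q) :
    HasDerivAt (fun q => p * Real.log (p / q)) (-(p * q⁻¹)) q := by
  rcases eq_or_ne p 0 with rfl | hp
  · simpa using hasDerivAt_const q (0 : ℝ)
  · have e : (fun q => p * Real.log (p / q)) =ᶠ[𝓝 q]
        fun q => p * (Real.log p - Real.log q) := by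
      filter_upwards [eventually_ne_nhds hq.ne'] with q' hq'
      rw [Real.log_div hp hq']
    refine HasDerivAt.congr_of_eventuallyEq ?_ e
    refine (((Real.hasDerivAt_log hq.ne').const_sub _).const_mul p).congr_deriv ?_
    ring

lemma hasFDerivAt_dpd_cellProb (β : ℝ) (p : Fin (P.L + 1) → ℝ) {θ : Param}
    (hθ : θ ∈ paramSpace) :
    HasFDerivAt (fun θ => P.dpd β p (P.cellProb θ))
      (paramFunctional ((1 + β) • (P.scoreMatrix β θ *ᵥ (P.cellProb θ - p)))) θ := by
  have hpos := P.cellProb_pos hθ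
  let w : Fin (P.L + 1) → Fin 2 → ℝ := P.W θ
  have hw : ∀ j, HasFDerivAt (fun θ => P.cellProb θ j) (paramFunctional (w j)) θ :=
    P.hasFDerivAt_cellProb hθ
  have hvec : P.scoreMatrix β θ *ᵥ (P.cellProb θ - p) =
      ∑ j, (P.cellProb θ j ^ (β - 1) * (P.cellProb θ j - p j)) • w j := by
    ext c
    rw [Finset.sum_apply (M := fun _ : Fin 2 => ℝ), Matrix.mulVec, dotProduct]
    refine Finset.sum_congr rfl fun j _ => ?_
    rw [scoreMatrix_apply]
    simp only [Pi.sub_apply, Pi.smul_apply, smul_eq_mul]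
    ring
  unfold dpd
  split_ifs with h
  · subst h
    have hsum := HasFDerivAt.fun_sum (u := Finset.univ) fun j _ =>
      (hasDerivAt_mul_log_div (p j) (hpos j)).comp_hasFDerivAt θ (hw j)
    refine hsum.congr_fderiv ?_
    simp_rw [← paramFunctional_smul]
    rw [← paramFunctional_sum]
    congr 1
    -- For `β = 0` the derivative involves only `-p j / π j`; adding the zero sum of the rows turns
    -- it into `(π j - p j) / π j`.
    have hW : ∑ j, w j = 0 := by
      ext c
      rw [Finset.sum_apply (M := fun _ : Fin 2 => ℝ)]
      exact P.sum_W θ c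
    rw [hvec, add_zero, one_smul]
    rw [← sub_eq_zero, ← Finset.sum_sub_distrib, ← neg_eq_zero, ← Finset.sum_neg_distrib, ← hW]
    refine Finset.sum_congr rfl fun j _ => ?_
    rw [← sub_smul, ← neg_smul, zero_sub, Real.rpow_neg_one]
    have := (hpos j).ne'
    have e : -(-(p j * (P.cellProb θ j)⁻¹) - (P.cellProb θ j)⁻¹ * (P.cellProb θ j - p j)) =
        1 := by
      field_simp
      ring
    rw [e, one_smul]
  · have hsum := HasFDerivAt.fun_sum (u := Finset.univ) fun j _ =>
      (hasDerivAt_dpd_summand h (p j) (hpos j)).comp_hasFDerivAt θ (hw j)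
    refine hsum.congr_fderiv ?_
    simp_rw [← paramFunctional_smul]
    rw [← paramFunctional_sum, hvec, Finset.smul_sum]
    simp_rw [smul_smul]

lemma IsMDPDE.scoreMatrix_mulVec_eq_zero {P : StepStressPlan} {β : ℝ} (hβ : 0 ≤ β)
    {p : Fin (P.L + 1) → ℝ} {θ : Param} (h : P.IsMDPDE β p θ) :
    P.scoreMatrix β θ *ᵥ (P.cellProb θ - p) = 0 := by
  have hmin := h.2.isLocalMin (isOpen_paramSpace.mem_nhds h.1)
  have h0 := hmin.hasFDerivAt_eq_zero (P.hasFDerivAt_dpd_cellProb β p h.1)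
  ext c
  have h1 := congrArg (fun f => f (EuclideanSpace.single c (1 : ℝ))) h0
  simp only [paramFunctional_apply, PiLp.ofLp_single, dotProduct_single_one,
    Pi.smul_apply, smul_eq_mul, zero_apply] at h1
  exact (mul_eq_zero.1 h1).resolve_left (by linarith)

/-- Near the model vector at `θ₀`, the estimate exists. -/
lemma eventually_exists_isMDPDE {β : ℝ} (hβ : 0 ≤ β) {θ₀ : Param} (hθ₀ : θ₀ ∈ paramSpace) :
    ∀ᶠ p in 𝓝[stdSimplex ℝ _] (P.cellProb θ₀), ∃ θ, P.IsMDPDE β p θ := by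
  obtain ⟨r, hr, hball⟩ := Metric.nhds_basis_closedBall.mem_iff.1
    (isOpen_paramSpace.mem_nhds hθ₀)
  -- Convergence along this filter of pairs is uniform: for `p` near the model vector, every
  -- parameter fitting as well as `θ₀` lies in the ball. A minimizer over the compact ball is
  -- therefore global.
  set l : Filter ((Fin (P.L + 1) → ℝ) × Param) :=
    comap Prod.fst (𝓝[stdSimplex ℝ _] (P.cellProb θ₀)) ⊓
      𝓟 {x | x.2 ∈ paramSpace ∧
        P.dpd β x.1 (P.cellProb x.2) ≤ P.dpd β x.1 (P.cellProb θ₀)} with hl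
  have hmem : ∀ᶠ x in l, x.2 ∈ paramSpace ∧
      P.dpd β x.1 (P.cellProb x.2) ≤ P.dpd β x.1 (P.cellProb θ₀) :=
    mem_inf_of_right (mem_principal_self _)
  have hfst : Tendsto Prod.fst l (𝓝[stdSimplex ℝ _] (P.cellProb θ₀)) :=
    tendsto_comap.mono_left inf_le_left
  have ht : Tendsto Prod.snd l (𝓝 θ₀) :=
    P.tendsto_of_dpd_le hβ hθ₀ (hfst.mono_right nhdsWithin_le_nhds)
      (hfst.eventually self_mem_nhdsWithin) (hmem.mono fun _ h => h.1) (hmem.mono fun _ h => h.2)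
  have hev := ht.eventually (Metric.closedBall_mem_nhds θ₀ hr)
  rw [hl, eventually_inf_principal, eventually_comap] at hev
  filter_upwards [hev] with p hp
  have hcont : ContinuousOn (fun θ => P.dpd β p (P.cellProb θ)) (Metric.closedBall θ₀ r) :=
    fun θ hθ => (P.hasFDerivAt_dpd_cellProb β p (hball hθ)).continuousAt.continuousWithinAt
  obtain ⟨θ, hθ, hmin⟩ := (isCompact_closedBall θ₀ r).exists_isMinOn
    ⟨θ₀, Metric.mem_closedBall_self hr.le⟩ hcont
  refine ⟨θ, hball hθ, fun θ' hθ' => ?_⟩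
  by_cases hle : P.dpd β p (P.cellProb θ') ≤ P.dpd β p (P.cellProb θ₀)
  · exact hmin (hp (p, θ') rfl ⟨hθ', hle⟩)
  · exact (hmin (Metric.mem_closedBall_self hr.le)).trans (not_le.1 hle).le

end StepStressPlan

/-! ### Asymptotic linearity of the estimator -/

open Asymptotics in
lemma isLittleO_mulVec {ι m n E : Type*} [Fintype m] [Fintype n] [NormedAddCommGroup E]
    {l : Filter ι} {M : ι → Matrix m n ℝ} {f : ι → n → ℝ} {g : ι → E}
    (hM : ∀ i j, (fun a => M a i j) =O[l] fun _ => (1 : ℝ)) (hf : f =o[l] g) :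
    (fun a => M a *ᵥ f a) =o[l] g := by
  refine isLittleO_pi.2 fun i => ?_
  have h := IsLittleO.fun_sum (s := Finset.univ) fun j _ =>
    (hM i j).mul_isLittleO (isLittleO_pi.1 hf.norm_right j)
  simp only [one_mul] at h
  exact h.of_norm_right

open Asymptotics in
lemma isLittleO_mulVec_of_tendsto_zero {ι m n E : Type*} [Fintype m] [Fintype n]
    [NormedAddCommGroup E]
    {l : Filter ι} {M : ι → Matrix m n ℝ} {f : ι → n → ℝ} {g : ι → E}
    (hM : ∀ i j, Tendsto (fun a => M a i j) l (𝓝 0)) (hf : f =O[l] g) :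
    (fun a => M a *ᵥ f a) =o[l] g := by
  refine isLittleO_pi.2 fun i => ?_
  have h := IsLittleO.fun_sum (s := Finset.univ) fun j _ =>
    ((isLittleO_one_iff ℝ).2 (hM i j)).mul_isBigO (isBigO_pi.1 hf.norm_right j)
  simp only [one_mul] at h
  exact h.of_norm_right

open Asymptotics in
lemma isBigO_ofLp {ι : Type*} {l : Filter ι} (f : ι → Param) :
    f =O[l] fun a => (f a).ofLp :=
  ((PiLp.continuousLinearEquiv 2 ℝ (fun _ : Fin 2 => ℝ)).symm :
    (Fin 2 → ℝ) →L[ℝ] Param).isBigO_comp (fun a => (f a).ofLp) l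

namespace StepStressPlan

variable (P : StepStressPlan)

/-- The quadratic form of `J` is a sum of squares of the entries of `W v` with positive weights, and
`W` is injective. -/
lemma J_mulVec_eq_zero {β : ℝ} {θ : Param} (hθ : θ ∈ paramSpace) {v : Fin 2 → ℝ}
    (hv : P.J β θ *ᵥ v = 0) : v = 0 := by
  refine P.eq_zero_of_W_mulVec hθ ?_
  have h : v ⬝ᵥ (P.J β θ *ᵥ v) =
      ∑ j, P.cellProb θ j ^ (β - 1) * (P.W θ *ᵥ v) j ^ 2 := by
    rw [J, ← Matrix.mulVec_mulVec, ← Matrix.mulVec_mulVec, Matrix.dotProduct_mulVec,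
      Matrix.vecMul_transpose, dotProduct]
    refine Finset.sum_congr rfl fun j _ => ?_
    rw [Matrix.mulVec_diagonal]
    ring
  rw [hv, dotProduct_zero] at h
  have hpos := fun j => Real.rpow_pos_of_pos (P.cellProb_pos hθ j) (β - 1)
  have h2 := (Finset.sum_eq_zero_iff_of_nonneg
    (fun j _ => mul_nonneg (hpos j).le (sq_nonneg _))).1 h.symm
  ext j
  have h3 := (mul_eq_zero.1 (h2 j (Finset.mem_univ j))).resolve_left (hpos j).ne'
  exact pow_eq_zero_iff two_ne_zero |>.1 h3

lemma isUnit_det_J (β : ℝ) {θ : Param} (hθ : θ ∈ paramSpace) : IsUnit (P.J β θ).det := by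
  rw [isUnit_iff_ne_zero]
  intro h
  obtain ⟨v, hv, hv0⟩ := Matrix.exists_mulVec_eq_zero_iff.2 h
  exact hv (P.J_mulVec_eq_zero hθ hv0)

lemma J_isSymm (β : ℝ) (θ : Param) : (P.J β θ).IsSymm := by
  unfold Matrix.IsSymm J
  simp only [Matrix.transpose_mul, Matrix.transpose_transpose, Matrix.diagonal_transpose,
    Matrix.mul_assoc]

/-- The influence of the cell frequencies on a function of the estimator with gradient `g`. -/
def influence (β : ℝ) (θ : Param) (g : Fin 2 → ℝ) : Fin (P.L + 1) → ℝ :=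
  g ᵥ* ((P.J β θ)⁻¹ * P.scoreMatrix β θ)

open Asymptotics in
/-- Solutions of the estimating equation that converge to `θ` are asymptotically linear. -/
lemma isLittleO_of_scoreMatrix_mulVec_eq_zero {ι : Type*} {l : Filter ι} (β : ℝ) {θ : Param}
    (hθ : θ ∈ paramSpace) {p : ι → Fin (P.L + 1) → ℝ} {u : ι → Param}
    (hu : Tendsto u l (𝓝 θ))
    (h0 : ∀ᶠ a in l, P.scoreMatrix β (u a) *ᵥ (P.cellProb (u a) - p a) = 0) :
    (fun a => (u a - θ).ofLp -
      ((P.J β θ)⁻¹ * P.scoreMatrix β θ) *ᵥ (p a - P.cellProb θ)) =o[l]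
        (fun a => p a - P.cellProb θ) := by
  set d : ι → Fin 2 → ℝ := fun a => (u a - θ).ofLp with hd
  set v : ι → Fin (P.L + 1) → ℝ := fun a => p a - P.cellProb θ with hv
  set B := P.scoreMatrix β with hB
  set M := (P.J β θ)⁻¹ * B θ with hM
  set r : ι → Fin (P.L + 1) → ℝ := fun a => P.cellProb (u a) - P.cellProb θ - P.W θ *ᵥ d a
    with hr
  -- No rate for `d` is known yet, so errors are measured against `d` and `v` jointly; `d` is
  -- absorbed at the end.
  set e : ι → (Fin 2 → ℝ) × (Fin (P.L + 1) → ℝ) := fun a => (d a, v a) with he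
  have hde : d =O[l] e := isBigO_of_le _ fun a => le_max_left _ _
  have hve : v =O[l] e := isBigO_of_le _ fun a => le_max_right _ _
  have hrd : r =o[l] d := by
    refine isLittleO_pi.2 fun j => ?_
    have h := (P.hasFDerivAt_cellProb hθ j).isLittleO.comp_tendsto hu
    refine (h.congr_left fun a => ?_).trans_isBigO (isBigO_ofLp fun a => u a - θ)
    simp only [Function.comp, paramFunctional_apply, hr, Pi.sub_apply]
    rfl
  have hE : ∀ i j, Tendsto (fun a => (B (u a) - B θ) i j) l (𝓝 0) := by
    intro i j
    have h := ((P.continuousAt_scoreMatrix β hθ i j).tendsto.comp hu).sub_const (B θ i j)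
    rw [sub_self] at h
    exact h
  have hBO : ∀ i j, (fun a => B (u a) i j) =O[l] fun _ => (1 : ℝ) := fun i j =>
    ((P.continuousAt_scoreMatrix β hθ i j).tendsto.comp hu).isBigO_one ℝ
  have hconst : ∀ {m n : Type} (A : Matrix m n ℝ) (i : m) (j : n),
      (fun _ : ι => A i j) =O[l] fun _ => (1 : ℝ) := fun A i j => isBigO_const_const _ one_ne_zero _
  have hWd : (fun a => P.W θ *ᵥ d a) =O[l] e := by
    have := ((Matrix.mulVecLin (P.W θ)).toContinuousLinearMap.isBigO_comp d l)
    exact this.trans hde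
  have key : (fun a => d a - M *ᵥ v a) =o[l] e := by
    have h1 : (fun a => (P.J β θ)⁻¹ *ᵥ ((B (u a) - B θ) *ᵥ v a -
        (B (u a) - B θ) *ᵥ (P.W θ *ᵥ d a) - B (u a) *ᵥ r a)) =o[l] e :=
      isLittleO_mulVec (hconst _) (((isLittleO_mulVec_of_tendsto_zero hE hve).sub
        (isLittleO_mulVec_of_tendsto_zero hE hWd)).sub
          (isLittleO_mulVec hBO (hrd.trans_isBigO hde)))
    refine h1.congr' ?_ EventuallyEq.rfl
    filter_upwards [h0] with a ha
    have e1 : P.cellProb (u a) - p a = P.W θ *ᵥ d a + r a - v a := by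
      simp only [hr, hv]
      abel
    rw [e1, Matrix.mulVec_sub, Matrix.mulVec_add] at ha
    have e2 : (B (u a) - B θ) *ᵥ v a - (B (u a) - B θ) *ᵥ (P.W θ *ᵥ d a) - B (u a) *ᵥ r a =
        B θ *ᵥ (P.W θ *ᵥ d a) - B θ *ᵥ v a := by
      rw [Matrix.sub_mulVec, Matrix.sub_mulVec]
      rw [← sub_eq_zero, ← neg_eq_zero, ← ha]
      abel
    rw [e2, Matrix.mulVec_sub, Matrix.mulVec_mulVec (d a), ← J_eq, Matrix.mulVec_mulVec,
      Matrix.nonsing_inv_mul _ (P.isUnit_det_J β hθ), Matrix.one_mulVec, Matrix.mulVec_mulVec]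
  have hMv : (fun a => M *ᵥ v a) =O[l] v :=
    (Matrix.mulVecLin M).toContinuousLinearMap.isBigO_comp v l
  have hed : e =O[l] v := by
    have h2 : (fun a => ‖e a‖) =O[l] v := by
      -- With factor `1 / 2`, `‖e‖ ≤ ‖d‖ + ‖v‖ ≤ ‖e‖ / 2 + (|C| + 1) ‖v‖`, which gives the constant
      -- `2 * (|C| + 1)`.
      have h3 := key.def (c := 1 / 2) (by norm_num)
      obtain ⟨C, hC⟩ := hMv.bound
      refine IsBigO.of_bound (2 * (|C| + 1)) ?_
      filter_upwards [h3, hC] with a h4 h5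
      have h6 : ‖d a‖ ≤ ‖d a - M *ᵥ v a‖ + ‖M *ᵥ v a‖ := by
        simpa using norm_add_le (d a - M *ᵥ v a) (M *ᵥ v a)
      have h7 : ‖e a‖ ≤ ‖d a‖ + ‖v a‖ := by
        rw [he, Prod.norm_mk]
        exact max_le_add_of_nonneg (norm_nonneg _) (norm_nonneg _)
      have h8 : C * ‖v a‖ ≤ |C| * ‖v a‖ :=
        mul_le_mul_of_nonneg_right (le_abs_self C) (norm_nonneg _)
      rw [norm_norm]
      linarith
    exact h2.of_norm_left
  exact key.trans_isBigO hed

open Asymptotics in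
lemma isLittleO_comp_of_scoreMatrix_mulVec_eq_zero {ι : Type*} {l : Filter ι} (β : ℝ)
    {θ : Param} (hθ : θ ∈ paramSpace) {p : ι → Fin (P.L + 1) → ℝ} {u : ι → Param}
    (hu : Tendsto u l (𝓝 θ))
    (h0 : ∀ᶠ a in l, P.scoreMatrix β (u a) *ᵥ (P.cellProb (u a) - p a) = 0)
    {h : Param → ℝ} {g : Param} (hh : HasGradientAt h g θ) :
    (fun a => h (u a) - h θ - P.influence β θ g.ofLp ⬝ᵥ (p a - P.cellProb θ)) =o[l]
        (fun a => p a - P.cellProb θ) := by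
  have h1 := P.isLittleO_of_scoreMatrix_mulVec_eq_zero β hθ hu h0
  set M := (P.J β θ)⁻¹ * P.scoreMatrix β θ with hM
  have hMv : (fun a => M *ᵥ (p a - P.cellProb θ)) =O[l] fun a => p a - P.cellProb θ :=
    (Matrix.mulVecLin M).toContinuousLinearMap.isBigO_comp _ l
  have hd : (fun a => u a - θ) =O[l] fun a => p a - P.cellProb θ :=
    (isBigO_ofLp _).trans ((h1.isBigO.add hMv).congr_left fun a => sub_add_cancel _ _)
  have h2 := (hh.hasFDerivAt.isLittleO.comp_tendsto hu).trans_isBigO hd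
  have h3 : (fun a => g.ofLp ⬝ᵥ ((u a - θ).ofLp - M *ᵥ (p a - P.cellProb θ))) =o[l]
      fun a => p a - P.cellProb θ := by
    refine ((LinearMap.toContinuousLinearMap
      (dotProductBilin ℝ ℝ g.ofLp)).isBigO_comp _ l).trans_isLittleO h1
  refine (h2.add h3).congr_left fun a => ?_
  have e1 : (InnerProductSpace.toDual ℝ Param g) (u a - θ) = g.ofLp ⬝ᵥ (u a - θ).ofLp := by
    rw [InnerProductSpace.toDual_apply_apply, EuclideanSpace.inner_eq_star_dotProduct,
      dotProduct_comm]
    simp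
  have e2 : P.influence β θ g.ofLp ⬝ᵥ (p a - P.cellProb θ) =
      g.ofLp ⬝ᵥ (M *ᵥ (p a - P.cellProb θ)) := by
    rw [influence, ← Matrix.dotProduct_mulVec]
  rw [e2, dotProduct_sub]
  simp only [Function.comp]
  rw [e1]
  ring

/-- Asymptotic linearity of a function of the estimator, uniformly over all estimates. -/
lemma eventually_forall_isMDPDE_abs_le {β : ℝ} (hβ : 0 ≤ β) {θ₀ : Param}
    (hθ₀ : θ₀ ∈ paramSpace) {h : Param → ℝ} {g : Param} (hh : HasGradientAt h g θ₀)
    {ε : ℝ} (hε : 0 < ε) :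
    ∀ᶠ p in 𝓝[stdSimplex ℝ _] (P.cellProb θ₀), ∀ θ, P.IsMDPDE β p θ →
      |h θ - h θ₀ - P.influence β θ₀ g.ofLp ⬝ᵥ (p - P.cellProb θ₀)| ≤
        ε * ‖p - P.cellProb θ₀‖ := by
  -- Letting the pair `(p, θ)` vary over all minimizers makes the expansion uniform, so no selection
  -- of a minimizer is needed.
  set l : Filter ((Fin (P.L + 1) → ℝ) × Param) :=
    comap Prod.fst (𝓝[stdSimplex ℝ _] (P.cellProb θ₀)) ⊓ 𝓟 {x | P.IsMDPDE β x.1 x.2} with hl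
  have hmem : ∀ᶠ x in l, P.IsMDPDE β x.1 x.2 := mem_inf_of_right (mem_principal_self _)
  have hfst : Tendsto Prod.fst l (𝓝[stdSimplex ℝ _] (P.cellProb θ₀)) :=
    tendsto_comap.mono_left inf_le_left
  have ht : Tendsto Prod.snd l (𝓝 θ₀) :=
    P.tendsto_of_dpd_le hβ hθ₀ (hfst.mono_right nhdsWithin_le_nhds)
      (hfst.eventually self_mem_nhdsWithin) (hmem.mono fun _ h => h.1)
      (hmem.mono fun _ h => h.2 hθ₀)
  have hlin := (P.isLittleO_comp_of_scoreMatrix_mulVec_eq_zero β hθ₀ ht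
    (hmem.mono fun _ h => h.scoreMatrix_mulVec_eq_zero hβ) hh).def hε
  rw [hl, eventually_inf_principal, eventually_comap] at hlin
  filter_upwards [hlin] with p hp θ hθ
  exact hp (p, θ) rfl hθ

/-! ### Influence vector, sandwich variance and gradient of the quantile -/

lemma influence_apply (β : ℝ) (θ : Param) (g : Fin 2 → ℝ) (j : Fin (P.L + 1)) :
    P.influence β θ g j = P.cellProb θ j ^ (β - 1) * (P.W θ *ᵥ ((P.J β θ)⁻¹ *ᵥ g)) j := by
  rw [influence, ← Matrix.vecMul_vecMul, scoreMatrix, ← Matrix.vecMul_vecMul,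
    Matrix.vecMul_diagonal, Matrix.vecMul_transpose, ← Matrix.mulVec_transpose,
    Matrix.transpose_nonsing_inv, (P.J_isSymm β θ).eq, mul_comm]

/-- The asymptotic variance is the variance of the influence of a single observation. -/
lemma dotProduct_sandwich_mulVec (β : ℝ) {θ : Param} (hθ : θ ∈ paramSpace) (g : Fin 2 → ℝ) :
    g ⬝ᵥ (((P.J β θ)⁻¹ * P.K β θ * (P.J β θ)⁻¹) *ᵥ g) =
      ∑ j, P.cellProb θ j * P.influence β θ g j ^ 2 -
        (∑ j, P.cellProb θ j * P.influence β θ g j) ^ 2 := by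
  set y := P.W θ *ᵥ ((P.J β θ)⁻¹ *ᵥ g) with hy
  have hpos := P.cellProb_pos hθ
  have e1 : g ⬝ᵥ (((P.J β θ)⁻¹ * P.K β θ * (P.J β θ)⁻¹) *ᵥ g) =
      y ⬝ᵥ ((Matrix.diagonal (fun j => P.cellProb θ j ^ (2 * β - 1)) -
        Matrix.vecMulVec (fun j => P.cellProb θ j ^ β) (fun j => P.cellProb θ j ^ β)) *ᵥ y) := by
    rw [← Matrix.mulVec_mulVec, ← Matrix.mulVec_mulVec, K, ← Matrix.mulVec_mulVec,
      ← Matrix.mulVec_mulVec, Matrix.dotProduct_mulVec, ← Matrix.mulVec_transpose,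
      Matrix.transpose_nonsing_inv, (P.J_isSymm β θ).eq, Matrix.dotProduct_mulVec,
      Matrix.vecMul_transpose]
  rw [e1, Matrix.sub_mulVec, dotProduct_sub, Matrix.vecMulVec_mulVec]
  congr 1
  · rw [dotProduct]
    refine Finset.sum_congr rfl fun j _ => ?_
    rw [Matrix.mulVec_diagonal, influence_apply, ← hy]
    have e2 : P.cellProb θ j ^ (2 * β - 1) =
        P.cellProb θ j * (P.cellProb θ j ^ (β - 1)) ^ 2 := by
      rw [← Real.rpow_natCast, ← Real.rpow_mul (hpos j).le]
      nth_rewrite 2 [← Real.rpow_one (P.cellProb θ j)]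
      rw [← Real.rpow_add (hpos j)]
      congr 1
      push_cast
      ring
    rw [e2]
    ring
  · have e3 : ∑ j, P.cellProb θ j * P.influence β θ g j =
        (fun j => P.cellProb θ j ^ β) ⬝ᵥ y := by
      rw [dotProduct]
      refine Finset.sum_congr rfl fun j _ => ?_
      rw [influence_apply, ← hy, ← mul_assoc, mul_comm (P.cellProb θ j),
        ← Real.rpow_add_one (hpos j).ne', sub_add_cancel]
    rw [e3, dotProduct_smul, dotProduct_comm y]
    simp [sq]

end StepStressPlan

lemma hasGradientAt_quantileAt (α x₀ : ℝ) {θ : Param} (hθ : θ ∈ paramSpace) :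
    HasGradientAt (quantileAt α x₀) (quantileGrad α x₀ θ) θ := by
  rw [hasGradientAt_iff_hasFDerivAt]
  have hF := (failureRate_pos hθ x₀).ne'
  have h := ((hasDerivAt_inv hF).const_mul (-Real.log (1 - α))).comp_hasFDerivAt θ
    (hasFDerivAt_failureRate hθ x₀)
  refine h.congr_fderiv ?_
  ext v
  have hne : θ 0 ≠ 0 := ne_of_gt hθ
  rw [InnerProductSpace.toDual_apply_apply, EuclideanSpace.inner_eq_star_dotProduct]
  have e : Real.exp (-(θ 1 * x₀)) * Real.exp (θ 1 * x₀) = 1 := by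
    rw [← Real.exp_add]
    simp
  have hexp := (Real.exp_pos (θ 1 * x₀)).ne'
  simp [paramFunctional_apply, dotProduct, Fin.sum_univ_two, quantileGrad, failureRate,
    Real.exp_neg]
  field_simp

/-! ### Negligible remainders -/

/-- A remainder that is of smaller order than a quantity bounded in probability tends to zero in
probability. -/
lemma tendstoInMeasure_zero_of_tight {Ω : Type*} [MeasurableSpace Ω] {μ : Measure Ω}
    [IsProbabilityMeasure μ] {R s : ℕ → Ω → ℝ} {C : ℝ}
    (hC : ∀ N, 1 ≤ N → ∀ M, 0 < M → μ.real {ω | M ≤ s N ω} ≤ C / M ^ 2)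
    (hR : ∀ ε, 0 < ε → ∃ δ, 0 < δ ∧ ∀ N : ℕ, 1 ≤ N → ∀ᵐ ω ∂μ, s N ω < δ * √N →
      |R N ω| ≤ ε * s N ω) :
    TendstoInMeasure μ R atTop 0 := by
  rw [tendstoInMeasure_iff_measureReal_norm]
  intro η hη
  refine squeeze_zero_norm' (a := fun N : ℕ => μ.real {ω | η ≤ ‖R N ω - (0 : Ω → ℝ) ω‖})
    (Eventually.of_forall fun N => ?_) ?_
  · rw [Real.norm_of_nonneg measureReal_nonneg]
  rw [Metric.tendsto_atTop]
  intro κ hκ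
  have hlim : Tendsto (fun M : ℝ => C / M ^ 2) atTop (𝓝 0) :=
    tendsto_const_nhds.div_atTop (tendsto_pow_atTop two_ne_zero)
  obtain ⟨M, hM, hM0⟩ := ((hlim.eventually (gt_mem_nhds hκ)).and (eventually_gt_atTop 0)).exists
  -- With this factor, `s < M` forces `|R| ≤ η / 2 < η` once `δ √N ≥ M`, so the bad event lies in
  -- `{M ≤ s}`, of probability below `κ`.
  obtain ⟨δ, hδ, h⟩ := hR (η / (2 * M)) (by positivity)
  have hN : Tendsto (fun N : ℕ => δ * √(N : ℝ)) atTop atTop :=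
    (Real.tendsto_sqrt_atTop.comp tendsto_natCast_atTop_atTop).const_mul_atTop hδ
  obtain ⟨N₀, hN₀⟩ := ((hN.eventually_ge_atTop M).and
    (eventually_ge_atTop 1)).exists_forall_of_atTop
  refine ⟨N₀, fun N hN' => ?_⟩
  obtain ⟨hNM, hN1⟩ := hN₀ N hN'
  rw [Real.dist_eq, sub_zero, abs_of_nonneg measureReal_nonneg]
  refine lt_of_le_of_lt (le_trans (ENNReal.toReal_mono (measure_ne_top _ _)
    (measure_mono_ae ?_)) (hC N hN1 M hM0)) hM
  filter_upwards [h N hN1] with ω hω hmem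
  by_contra hlt
  have hlt' : s N ω < M := not_le.1 hlt
  have h1 := hω (hlt'.trans_le hNM)
  have h2 : η / (2 * M) * s N ω ≤ η / (2 * M) * M :=
    mul_le_mul_of_nonneg_left hlt'.le (by positivity)
  have h3 : η / (2 * M) * M = η / 2 := by field_simp
  have h4 : η ≤ ‖R N ω - (0 : Ω → ℝ) ω‖ := hmem
  rw [Pi.zero_apply, sub_zero, Real.norm_eq_abs] at h4
  linarith

/-! ### Empirical frequencies as sample means -/

namespace StepStressPlan

variable (P : StepStressPlan)

lemma measurableSet_cell (j : Fin (P.L + 1)) : MeasurableSet (P.cell j) := by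
  unfold cell
  split_ifs
  · exact measurableSet_Ioc
  · exact measurableSet_Ioi

lemma cell_unique {s : ℝ} {i j : Fin (P.L + 1)} (hi : s ∈ P.cell i) (hj : s ∈ P.cell j) :
    i = j := by
  have aux : ∀ {i j : Fin (P.L + 1)}, s ∈ P.cell i → s ∈ P.cell j → ¬ i < j := by
    intro i j hi hj hij
    have hij' : (i : ℕ) < j := hij
    have hjL := j.2
    rw [cell, if_pos (by omega)] at hi
    have h1 : P.t (i + 1) ≤ P.t j := P.t_strictMono.monotoneOn ⟨by omega, by omega⟩
      ⟨by omega, by omega⟩ (by omega)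
    unfold cell at hj
    split_ifs at hj with h
    · exact absurd (hi.2.trans h1) (not_le.2 hj.1)
    · have h2 : (j : ℕ) = P.L := by omega
      rw [h2] at h1
      exact absurd (hi.2.trans h1) (not_le.2 hj)
  exact le_antisymm (not_lt.1 (aux hj hi)) (not_lt.1 (aux hi hj))

lemma exists_mem_cell {s : ℝ} (hs : 0 < s) : ∃ j, s ∈ P.cell j := by
  by_cases hL : s ≤ P.t P.L
  · have hex : ∃ n, s ≤ P.t n := ⟨P.L, hL⟩
    classical
    have hle := Nat.find_le (h := hex) hL
    have h0 : Nat.find hex ≠ 0 := by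
      intro h
      have := Nat.find_spec hex
      rw [h, P.t_zero] at this
      linarith
    refine ⟨⟨Nat.find hex - 1, by omega⟩, ?_⟩
    rw [cell, if_pos (show Nat.find hex - 1 < P.L by omega)]
    refine ⟨not_le.1 (Nat.find_min hex (by simp only; omega)), ?_⟩
    simp only
    rw [Nat.sub_add_cancel (by omega)]
    exact Nat.find_spec hex
  · refine ⟨⟨P.L, by omega⟩, ?_⟩
    rw [cell, if_neg (by simp)]
    exact not_le.1 hL

/-- The step function on the lifetimes that takes the value `c j` on the `j`-th cell. -/
def cellScore (c : Fin (P.L + 1) → ℝ) (s : ℝ) : ℝ :=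
  ∑ j, c j * (P.cell j).indicator 1 s

lemma cellScore_of_mem (c : Fin (P.L + 1) → ℝ) {s : ℝ} {j : Fin (P.L + 1)}
    (hj : s ∈ P.cell j) : P.cellScore c s = c j := by
  rw [cellScore, Finset.sum_eq_single j]
  · simp [hj]
  · intro i _ hij
    have : s ∉ P.cell i := fun hi => hij (P.cell_unique hi hj)
    simp [this]
  · simp

lemma cellScore_of_forall_notMem (c : Fin (P.L + 1) → ℝ) {s : ℝ} (h : ∀ j, s ∉ P.cell j) :
    P.cellScore c s = 0 :=
  Finset.sum_eq_zero fun j _ => by simp [h j]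

/-- Cells are disjoint, so there are no cross terms; this makes the variance a plain weighted sum.
-/
lemma cellScore_sq (c : Fin (P.L + 1) → ℝ) (s : ℝ) :
    P.cellScore c s ^ 2 = P.cellScore (fun j => c j ^ 2) s := by
  by_cases h : ∃ j, s ∈ P.cell j
  · obtain ⟨j, hj⟩ := h
    rw [P.cellScore_of_mem _ hj, P.cellScore_of_mem _ hj]
  · rw [P.cellScore_of_forall_notMem _ (not_exists.1 h),
      P.cellScore_of_forall_notMem _ (not_exists.1 h)]
    norm_num

lemma measurable_cellScore (c : Fin (P.L + 1) → ℝ) : Measurable (P.cellScore c) :=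
  Finset.measurable_sum _ fun j _ =>
    ((measurable_one.indicator (P.measurableSet_cell j)).const_mul (c j))

lemma abs_cellScore_le (c : Fin (P.L + 1) → ℝ) (s : ℝ) : |P.cellScore c s| ≤ ∑ j, |c j| := by
  by_cases h : ∃ j, s ∈ P.cell j
  · obtain ⟨j, hj⟩ := h
    rw [P.cellScore_of_mem _ hj]
    exact Finset.single_le_sum (f := fun j => |c j|) (fun i _ => abs_nonneg _)
      (Finset.mem_univ j)
  · rw [P.cellScore_of_forall_notMem _ (not_exists.1 h), abs_zero]
    exact Finset.sum_nonneg fun i _ => abs_nonneg _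

lemma empirical_eq (N : ℕ) (T : ℕ → ℝ) (j : Fin (P.L + 1)) :
    P.empirical N T j = (∑ m ∈ Finset.range N, (P.cell j).indicator 1 (T m)) / N := by
  rw [empirical, count, Finset.card_filter]
  push_cast
  congr 1

lemma dotProduct_empirical (c : Fin (P.L + 1) → ℝ) (N : ℕ) (T : ℕ → ℝ) :
    c ⬝ᵥ P.empirical N T = (∑ m ∈ Finset.range N, P.cellScore c (T m)) / N := by
  simp only [dotProduct, empirical_eq, cellScore]
  rw [Finset.sum_comm, Finset.sum_div]
  exact Finset.sum_congr rfl fun j _ => by rw [← Finset.mul_sum, mul_div_assoc]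

lemma sqrt_mul_dotProduct_empirical_sub (c q : Fin (P.L + 1) → ℝ) (N : ℕ) (T : ℕ → ℝ) :
    √(N : ℝ) * (c ⬝ᵥ (P.empirical N T - q)) =
      (√(N : ℝ))⁻¹ * (∑ m ∈ Finset.range N, P.cellScore c (T m) - N * (c ⬝ᵥ q)) := by
  rw [dotProduct_sub, dotProduct_empirical]
  rcases Nat.eq_zero_or_pos N with rfl | hN
  · simp
  · have hN' : (0 : ℝ) < N := by exact_mod_cast hN
    have hs := (Real.sqrt_pos.2 hN').ne'
    have h2 := Real.sq_sqrt hN'.le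
    field_simp
    rw [h2]

lemma empirical_mem_stdSimplex {N : ℕ} (hN : 1 ≤ N) {T : ℕ → ℝ} (hT : ∀ m, 0 < T m) :
    P.empirical N T ∈ stdSimplex ℝ (Fin (P.L + 1)) := by
  refine ⟨fun j => by unfold empirical; positivity, ?_⟩
  -- The total frequency is the mean of the score with all values `1`; it equals one because each
  -- positive lifetime lies in some cell.
  have h := P.dotProduct_empirical 1 N T
  rw [one_dotProduct] at h
  rw [h, Finset.sum_congr rfl (g := fun _ => (1 : ℝ))]
  · have : (N : ℝ) ≠ 0 := by positivity
    simp [this]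
  · intro m _
    obtain ⟨j, hj⟩ := P.exists_mem_cell (hT m)
    rw [P.cellScore_of_mem _ hj]
    rfl

lemma lifetimeCDF_zero {θ : Param} (hθ : θ ∈ paramSpace) : P.lifetimeCDF θ 0 = 0 := by
  rw [P.lifetimeCDF_eq hθ le_rfl, cumHazard_zero]
  simp

/-! ### Law of the cell scores, central limit theorem and tightness -/

section Lifetime

variable {Ω : Type*} [MeasurableSpace Ω] {μ : Measure Ω} [IsProbabilityMeasure μ]

lemma measureReal_cell {θ : Param} {X : Ω → ℝ} (hX : Measurable X)
    (hlaw : ∀ s, μ.real {ω | X ω ≤ s} = P.lifetimeCDF θ s) (j : Fin (P.L + 1)) :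
    μ.real (X ⁻¹' P.cell j) = P.cellProb θ j := by
  have hm : ∀ s, MeasurableSet {ω | X ω ≤ s} := fun s => hX measurableSet_Iic
  unfold cell cellProb
  split_ifs with h
  · have e : X ⁻¹' Set.Ioc (P.t j) (P.t ((j : ℕ) + 1)) =
        {ω | X ω ≤ P.t ((j : ℕ) + 1)} \ {ω | X ω ≤ P.t j} := by
      ext ω
      simp [and_comm]
    have hlt : P.t j < P.t ((j : ℕ) + 1) := P.t_lt_t (Nat.lt_succ_self (j : ℕ)) h
    have hsub : {ω | X ω ≤ P.t j} ⊆ {ω | X ω ≤ P.t ((j : ℕ) + 1)} :=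
      fun ω (hω : X ω ≤ P.t j) => hω.trans hlt.le
    rw [e, measureReal_sdiff hsub (hm _), hlaw, hlaw]
  · have e : X ⁻¹' Set.Ioi (P.t P.L) = {ω | X ω ≤ P.t P.L}ᶜ := by
      ext ω
      simp
    rw [e, probReal_compl_eq_one_sub (hm _), hlaw]

lemma integral_cellScore {θ : Param} {X : Ω → ℝ} (hX : Measurable X)
    (hlaw : ∀ s, μ.real {ω | X ω ≤ s} = P.lifetimeCDF θ s) (c : Fin (P.L + 1) → ℝ) :
    ∫ ω, P.cellScore c (X ω) ∂μ = c ⬝ᵥ P.cellProb θ := by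
  have hm : ∀ j, MeasurableSet (X ⁻¹' P.cell j) := fun j => hX (P.measurableSet_cell j)
  have e : ∀ j, (fun ω => c j * (P.cell j).indicator 1 (X ω)) =
      fun ω => c j * (X ⁻¹' P.cell j).indicator (1 : Ω → ℝ) ω := fun j => rfl
  unfold cellScore
  rw [integral_finsetSum]
  · refine Finset.sum_congr rfl fun j _ => ?_
    rw [e, integral_const_mul, integral_indicator_one (hm j), P.measureReal_cell hX hlaw]
  · intro j _
    rw [e]
    exact ((integrable_const (1 : ℝ)).indicator (hm j)).const_mul _

lemma memLp_cellScore {X : Ω → ℝ} (hX : Measurable X) (c : Fin (P.L + 1) → ℝ) :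
    MemLp (fun ω => P.cellScore c (X ω)) 2 μ :=
  MemLp.of_bound ((P.measurable_cellScore c).comp hX).aestronglyMeasurable (∑ j, |c j|)
    (Eventually.of_forall fun _ => P.abs_cellScore_le c _)

lemma variance_cellScore {θ : Param} {X : Ω → ℝ} (hX : Measurable X)
    (hlaw : ∀ s, μ.real {ω | X ω ≤ s} = P.lifetimeCDF θ s) (c : Fin (P.L + 1) → ℝ) :
    Var[fun ω => P.cellScore c (X ω); μ] =
      ∑ j, P.cellProb θ j * c j ^ 2 - (∑ j, P.cellProb θ j * c j) ^ 2 := by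
  rw [variance_eq_sub (P.memLp_cellScore hX c)]
  simp only [Pi.pow_apply, cellScore_sq]
  rw [P.integral_cellScore hX hlaw, P.integral_cellScore hX hlaw]
  simp only [dotProduct, mul_comm]

variable {T : ℕ → Ω → ℝ}

lemma identDistrib_lifetime {θ : Param} (hT : ∀ m, Measurable (T m))
    (hlaw : ∀ m s, μ.real {ω | T m ω ≤ s} = P.lifetimeCDF θ s) (m : ℕ) :
    IdentDistrib (T m) (T 0) μ μ := by
  refine ⟨(hT m).aemeasurable, (hT 0).aemeasurable, ?_⟩
  have := Measure.isProbabilityMeasure_map (μ := μ) (hT m).aemeasurable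
  refine Measure.ext_of_Iic _ _ fun s => ?_
  rw [Measure.map_apply (hT m) measurableSet_Iic, Measure.map_apply (hT 0) measurableSet_Iic]
  have h : μ.real (T m ⁻¹' Set.Iic s) = μ.real (T 0 ⁻¹' Set.Iic s) :=
    (hlaw m s).trans (hlaw 0 s).symm
  exact (measureReal_eq_measureReal_iff).1 h

lemma ae_forall_lifetime_pos {θ : Param} (hθ : θ ∈ paramSpace)
    (hlaw : ∀ m s, μ.real {ω | T m ω ≤ s} = P.lifetimeCDF θ s) :
    ∀ᵐ ω ∂μ, ∀ m, 0 < T m ω := by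
  refine ae_all_iff.2 fun m => ?_
  rw [ae_iff]
  have h := hlaw m 0
  rw [P.lifetimeCDF_zero hθ, measureReal_eq_zero_iff] at h
  simpa using h

lemma tendstoInDistribution_sqrt_mul_empirical {θ : Param} (hT : ∀ m, Measurable (T m))
    (hindep : iIndepFun T μ) (hlaw : ∀ m s, μ.real {ω | T m ω ≤ s} = P.lifetimeCDF θ s)
    (c : Fin (P.L + 1) → ℝ) :
    TendstoInDistribution (fun (N : ℕ) ω =>
      √(N : ℝ) * (c ⬝ᵥ (P.empirical N (fun m => T m ω) - P.cellProb θ))) atTop (id : ℝ → ℝ)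
      (fun _ => μ) (gaussianReal 0
        (∑ j, P.cellProb θ j * c j ^ 2 - (∑ j, P.cellProb θ j * c j) ^ 2).toNNReal) := by
  simp_rw [sqrt_mul_dotProduct_empirical_sub]
  rw [← P.integral_cellScore (hT 0) (hlaw 0), ← P.variance_cellScore (hT 0) (hlaw 0)]
  exact tendstoInDistribution_inv_sqrt_mul_sum_sub (P := μ)
    (X := fun m ω => P.cellScore c (T m ω)) HasLaw.id (P.memLp_cellScore (hT 0) c)
    (hindep.comp (fun _ => P.cellScore c) fun _ => P.measurable_cellScore c)
    fun m => (P.identDistrib_lifetime hT hlaw m).comp (P.measurable_cellScore c)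

/-- Chebyshev's inequality; by independence the scaled sum has the variance of a single score, so
the bound is uniform in `N`. -/
lemma measureReal_le_abs_sqrt_mul_empirical {θ : Param} (hT : ∀ m, Measurable (T m))
    (hindep : iIndepFun T μ) (hlaw : ∀ m s, μ.real {ω | T m ω ≤ s} = P.lifetimeCDF θ s)
    (c : Fin (P.L + 1) → ℝ) {N : ℕ} (hN : 1 ≤ N) {M : ℝ} (hM : 0 < M) :
    μ.real {ω | M ≤ |√(N : ℝ) * (c ⬝ᵥ (P.empirical N (fun m => T m ω) - P.cellProb θ))|} ≤
      Var[fun ω => P.cellScore c (T 0 ω); μ] / M ^ 2 := by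
  have hN' : (0 : ℝ) < N := by exact_mod_cast hN
  set Y : ℕ → Ω → ℝ := fun m ω => P.cellScore c (T m ω) with hY
  set S : Ω → ℝ := fun ω => (√(N : ℝ))⁻¹ * (∑ m ∈ Finset.range N, Y m) ω with hS
  have hYm : ∀ m, MemLp (Y m) 2 μ := fun m => P.memLp_cellScore (hT m) c
  have hsum : MemLp (∑ m ∈ Finset.range N, Y m) 2 μ := memLp_finsetSum' _ fun m _ => hYm m
  have hSm : MemLp S 2 μ := hsum.const_mul _
  have hmean : μ[S] = (√(N : ℝ))⁻¹ * (N * (c ⬝ᵥ P.cellProb θ)) := by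
    rw [hS, integral_const_mul]
    simp only [Finset.sum_apply]
    rw [integral_finsetSum _ fun m _ => (hYm m).integrable one_le_two]
    simp only [hY, P.integral_cellScore (hT _) (hlaw _)]
    simp
  have hind : Set.Pairwise ↑(Finset.range N) fun i j => IndepFun (Y i) (Y j) μ :=
    fun i _ j _ hij => (hindep.comp (fun _ => P.cellScore c)
      fun _ => P.measurable_cellScore c).indepFun hij
  have hvar : Var[S; μ] = Var[fun ω => P.cellScore c (T 0 ω); μ] := by
    rw [hS, variance_const_mul, IndepFun.variance_sum (fun m _ => hYm m) hind,
      Finset.sum_congr rfl (g := fun _ => Var[fun ω => P.cellScore c (T 0 ω); μ])]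
    · rw [Finset.sum_const, Finset.card_range, nsmul_eq_mul, inv_pow, Real.sq_sqrt hN'.le,
        inv_mul_cancel_left₀ hN'.ne']
    · intro m _
      rw [P.variance_cellScore (hT 0) (hlaw 0), hY, P.variance_cellScore (hT m) (hlaw m)]
  have h := meas_ge_le_variance_div_sq hSm hM
  rw [hvar] at h
  have e : {ω | M ≤ |S ω - μ[S]|} =
      {ω | M ≤ |√(N : ℝ) * (c ⬝ᵥ (P.empirical N (fun m => T m ω) - P.cellProb θ))|} := by
    ext ω
    simp only [Set.mem_ofPred_eq]
    rw [sqrt_mul_dotProduct_empirical_sub, hmean, hS, mul_sub]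
    simp only [Finset.sum_apply, hY]
  rw [← e]
  exact ENNReal.toReal_le_of_le_ofReal
    (div_nonneg (variance_nonneg _ _) (sq_nonneg _)) h

/-- The centred and scaled cell frequencies are bounded in probability. -/
lemma measureReal_le_sqrt_mul_norm_empirical {θ : Param} (hT : ∀ m, Measurable (T m))
    (hindep : iIndepFun T μ) (hlaw : ∀ m s, μ.real {ω | T m ω ≤ s} = P.lifetimeCDF θ s) :
    ∃ C : ℝ, ∀ N : ℕ, 1 ≤ N → ∀ M, 0 < M →
      μ.real {ω | M ≤ √(N : ℝ) * ‖P.empirical N (fun m => T m ω) - P.cellProb θ‖} ≤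
        C / M ^ 2 := by
  refine ⟨∑ j, Var[fun ω => P.cellScore (Pi.single j 1) (T 0 ω); μ], fun N hN M hM => ?_⟩
  rw [Finset.sum_div]
  refine le_trans ?_ (Finset.sum_le_sum fun j _ =>
    P.measureReal_le_abs_sqrt_mul_empirical hT hindep hlaw (Pi.single j 1) hN hM)
  -- Union bound: the supremum norm reaches `M / √N` only if some coordinate does.
  refine le_trans (measureReal_mono ?_) (measureReal_iUnion_fintype_le _)
  intro ω hω
  rw [Set.mem_iUnion]
  by_contra hcon
  push Not at hcon
  simp only [Set.mem_ofPred_eq, not_le, single_one_dotProduct] at hcon hω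
  have hN' : (0 : ℝ) < N := by exact_mod_cast hN
  have hs := Real.sqrt_pos.2 hN'
  have h : ‖P.empirical N (fun m => T m ω) - P.cellProb θ‖ < M / √(N : ℝ) := by
    rw [pi_norm_lt_iff (by positivity)]
    intro j
    rw [lt_div_iff₀ hs, Real.norm_eq_abs, mul_comm, ← abs_of_pos hs, ← abs_mul]
    exact hcon j
  rw [lt_div_iff₀ hs, mul_comm] at h
  linarith

end Lifetime

end StepStressPlan

lemma measurable_quantileAt (α x₀ : ℝ) : Measurable (quantileAt α x₀) := by
  unfold quantileAt failureRate
  fun_prop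

end

theorem theorem8 (P : StepStressPlan) (x₀ α β : ℝ) (hα0 : 0 < α) (hα1 : α < 1) (hβ : 0 ≤ β)
    (θ₀ : Param) (hθ₀ : θ₀ ∈ paramSpace)
    {Ω : Type*} [MeasurableSpace Ω] (μ : Measure Ω) [IsProbabilityMeasure μ]
    -- independent lifetimes of the devices, with the model distribution at `θ₀`
    (T : ℕ → Ω → ℝ) (hT : ∀ m, Measurable (T m)) (hT_indep : iIndepFun T μ)
    (hT_law : ∀ m s, μ.real {ω | T m ω ≤ s} = P.lifetimeCDF θ₀ s)
    -- the estimator based on the first `N` devices, a minimizer whenever there is one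
    (θhat : ℕ → Ω → Param) (hθhat : ∀ N, AEMeasurable (θhat N) μ)
    (hθhat_min : ∀ N, ∀ᵐ ω ∂μ,
      (∃ θ, P.IsMDPDE β (P.empirical N (fun m => T m ω)) θ) →
        P.IsMDPDE β (P.empirical N (fun m => T m ω)) (θhat N ω)) :
    (∀ θ ∈ paramSpace, HasGradientAt (quantileAt α x₀) (quantileGrad α x₀ θ) θ) ∧
    IsUnit (P.J β θ₀).det ∧
    0 ≤ quantileVar P β α x₀ θ₀ ∧
    TendstoInDistribution
      (fun (N : ℕ) ω => √(N : ℝ) * (quantileAt α x₀ (θhat N ω) - quantileAt α x₀ θ₀))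
      atTop (id : ℝ → ℝ) (fun _ => μ)
      (gaussianReal 0 (quantileVar P β α x₀ θ₀).toNNReal) := by
  set c := P.influence β θ₀ (quantileGrad α x₀ θ₀).ofLp with hc
  have hvar : quantileVar P β α x₀ θ₀ =
      ∑ j, P.cellProb θ₀ j * c j ^ 2 - (∑ j, P.cellProb θ₀ j * c j) ^ 2 :=
    P.dotProduct_sandwich_mulVec β hθ₀ _
  have hgrad := hasGradientAt_quantileAt α x₀ hθ₀
  refine ⟨fun θ hθ => hasGradientAt_quantileAt α x₀ hθ, P.isUnit_det_J β hθ₀, ?_, ?_⟩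
  · rw [hvar, ← P.variance_cellScore (hT 0) (hT_law 0)]
    exact variance_nonneg _ _
  rw [hvar]
  refine tendstoInDistribution_of_tendstoInMeasure_sub _ _
    (P.tendstoInDistribution_sqrt_mul_empirical hT hT_indep hT_law c) ?_ fun N =>
      (((measurable_quantileAt α x₀).comp_aemeasurable (hθhat N)).sub_const _).const_mul _
  obtain ⟨C, hC⟩ := P.measureReal_le_sqrt_mul_norm_empirical hT hT_indep hT_law
  refine tendstoInMeasure_zero_of_tight hC fun ε hε => ?_
  -- Within distance `δ` of the model vector, inside the simplex, a minimizer exists and every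
  -- minimizer obeys the linear expansion; existence is what activates the hypothesis on `θhat`.
  obtain ⟨δ, hδ, hball⟩ := Metric.mem_nhdsWithin_iff.1
    ((P.eventually_exists_isMDPDE hβ hθ₀).and
      (P.eventually_forall_isMDPDE_abs_le hβ hθ₀ hgrad hε))
  refine ⟨δ, hδ, fun N hN => ?_⟩
  filter_upwards [P.ae_forall_lifetime_pos hθ₀ hT_law, hθhat_min N] with ω hpos hmin hlt
  have hs : 0 < √(N : ℝ) := Real.sqrt_pos.2 (by exact_mod_cast hN)
  have hdist : ‖P.empirical N (fun m => T m ω) - P.cellProb θ₀‖ < δ := by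
    rw [mul_comm] at hlt
    exact lt_of_mul_lt_mul_right hlt hs.le
  obtain ⟨hex, hlin⟩ := hball ⟨mem_ball_iff_norm.2 hdist, P.empirical_mem_stdSimplex hN hpos⟩
  have h := mul_le_mul_of_nonneg_left (hlin _ (hmin hex)) hs.le
  rw [← abs_of_pos hs, ← abs_mul, abs_of_pos hs, mul_sub] at h
  calc _ ≤ _ := h
    _ = _ := by ring
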